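/- Let $F$ be a field and let $n,w,\delta,s\ge 1$ and $\mu\ge 0$ be integers. Let $\mathcal C(n,w,\delta,s,\mu)$ be the class of all polynomials in $F[x_1,\dots,x_n]$ of the form $$C = D_0^{\top}\Big(\prod_{i=1}^{d} D_i\Big) D_{d+1},\qquad d\ge 0,$$ for which there is an (unknown) ordered partition $\mathbf x=\mathbf x_0\sqcup\mathbf x_1\sqcup\dots\sqcup\mathbf x_{d+1}$ of the variables such that $D_0\in F[\mathbf x_0]^w$, $D_{d+1}\in F[\mathbf x_{d+1}]^w$ and, for $1\le i\le d$, $D_i\in F[\mathbf x_i]^{w\times w}$ is invertible as a matrix of rational functions ($\det D_i\neq 0$); and such that each $D_i$, $0\le i\le d+1$, viewed as a polynomial with vector or matrix coefficients, has degree at most $\delta$ in every variable, has at most $s$ monomials with nonzero coefficient, and has at most $\mu$ variables in any such monomial. Put $\ell = 1+2\min\{\lceil\log_2(w^2s)\rceil,\mu\}$. Then $\mathcal C(n,w,\delta,s,\mu)$ has a hitting set of size, and computable in time, $\mathrm{poly}\big((n\delta s)^{\ell w^2}\big)$. Precisely: there are a single program $A$ (for a unit-cost random access machine that adds and subtracts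 natural numbers, performs ring operations on field elements, and can fetch the $k$-th element of a supplied sequence $a_0,a_1,\dots$ of field elements) and a single polynomial $P$ with natural coefficients such that, for all $n,w,\delta,s,\mu$ as above, all $F$, every field $K\supseteq F$ and every sequence $a$ in $K$ whose first $T:=P\big((n\delta s)^{\ell w^2}\big)$ terms are distinct, $A$ on input $(n,w,\delta,s,\mu)$ outputs within $T$ steps a list of at most $T$ points of $K^n$ such that every nonzero $C\in\mathcal C(n,w,\delta,s,\mu)$ is nonzero at one of these points. Likewise, if every factor $D_i$ ($0\le i\le d+1$) depends on at most one variable, with degree at most $\delta$ and no other bound on sparsity or support, then the class of the polynomials $C$ so obtained has in the same sense a hitting set of size, and computable in time, $\mathrm{poly}\big((n\delta)^{w^2}\big)$, which is polynomial in $n\delta$ for constant $w$; here the program only gets $(n,w,\delta)$ as input. -/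

import Mathlib

/-!
### Read-once oblivious ABPs with invertible middle factors
-/

/-- A width-`w` read-once oblivious algebraic branching program over `F` in `n` variables with
invertible middle factors, `left ᵀ * (mid 1 * ⋯ * mid d) * right`. The order and the partition
of the variables are part of the program: the variable `v` belongs to the block `block v`, where
the blocks are numbered `0, 1, …, d + 1`. A middle factor is invertible as a matrix over the field
of rational functions, that is, its determinant is a nonzero polynomial. -/
structure InvROABP (F : Type*) [Field F] (n w : ℕ) where
  d : ℕ
  block : Fin n → Fin (d + 2)
  left : Fin w → MvPolynomial (Fin n) F
  mid : Fin d → Matrix (Fin w) (Fin w) (MvPolynomial (Fin n) F)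
  right : Fin w → MvPolynomial (Fin n) F
  left_mem : ∀ k, left k ∈ MvPolynomial.supported F {v | block v = 0}
  mid_mem : ∀ i k l, mid i k l ∈ MvPolynomial.supported F {v | block v = i.castSucc.succ}
  right_mem : ∀ k, right k ∈ MvPolynomial.supported F {v | block v = Fin.last (d + 1)}
  mid_det : ∀ i, (mid i).det ≠ 0

namespace InvROABP

variable {F : Type*} [Field F] {n w : ℕ}

/-- The polynomial computed by the program. -/
noncomputable def poly (B : InvROABP F n w) : MvPolynomial (Fin n) F :=
  B.left ⬝ᵥ ((List.ofFn B.mid).prod.mulVec B.right)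

/-- The monomials (exponent vectors) with a nonzero coefficient in a polynomial whose coefficients
are vectors or matrices, given by the finite family of its entries: the coefficient of a monomial
is nonzero if and only if it is nonzero in some entry. -/
noncomputable def monomials {ι : Type*} [Fintype ι] (A : ι → MvPolynomial (Fin n) F) :
    Finset (Fin n →₀ ℕ) :=
  open Classical in Finset.univ.biUnion fun i => (A i).support

/-- The sets of monomials of all factors `D₀, D₁, …, D_{d+1}` have the property `Q`. -/
def EachFactor (B : InvROABP F n w) (Q : Finset (Fin n →₀ ℕ) → Prop) : Prop :=
  Q (monomials B.left) ∧
    (∀ i, Q (monomials fun p : Fin w × Fin w => B.mid i p.1 p.2)) ∧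
    Q (monomials B.right)

/-- Every factor has degree at most `δ` in every variable
(so in particular if its total degree is at most `δ`). -/
def DegreeLE (B : InvROABP F n w) (δ : ℕ) : Prop :=
  B.EachFactor fun S => ∀ m ∈ S, ∀ v, m v ≤ δ

/-- Every factor has at most `s` monomials. -/
def SparsityLE (B : InvROABP F n w) (s : ℕ) : Prop :=
  B.EachFactor fun S => S.card ≤ s

/-- Every monomial of every factor contains at most `μ` variables. -/
def SupportLE (B : InvROABP F n w) (μ : ℕ) : Prop :=
  B.EachFactor fun S => ∀ m ∈ S, m.support.card ≤ μ

/-- Every factor depends on at most one variable. -/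
def Univariate (B : InvROABP F n w) : Prop :=
  Function.Injective B.block

end InvROABP

/-!
### Random access machines over a field

The machine has number registers, with addition and truncated subtraction at unit cost and with
indirect addressing, and field registers with the ring operations at unit cost. It writes field
elements on an output tape.
-/

namespace FieldRAM

/-- Basic instructions; the arguments are addresses of registers (except for `c` in `const`). -/
inductive Instr : Type
  | const (x c : ℕ)
  | add (x y z : ℕ)
  | sub (x y z : ℕ)
  | load (x y : ℕ)
  | store (x y : ℕ)
  | fzero (x : ℕ)
  | fone (x : ℕ)
  | fadd (x y z : ℕ)
  | fsub (x y z : ℕ)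
  | fmul (x y z : ℕ)
  | fload (x y : ℕ)
  | fstore (x y : ℕ)
  | felem (x y : ℕ)
  | emit (x : ℕ)

/-- Programs; `ite x p q` and `loop x p` test whether the number register `x` is nonzero. -/
inductive Prog : Type
  | instr (i : Instr)
  | seq (p q : Prog)
  | ite (x : ℕ) (p q : Prog)
  | loop (x : ℕ) (p : Prog)

/-- The number registers, the field registers and the output written so far. -/
structure State (K : Type*) where
  reg : ℕ → ℕ
  fld : ℕ → K
  out : List K

variable {K : Type*} [Field K]

/-- The effect of a basic instruction. The sequence `a` is the machine's supply of elements of `K`: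
`felem x y` fetches the element whose index is the content of the number register `y`. -/
def Instr.step (a : ℕ → K) (σ : State K) : Instr → State K
  | const x c => { σ with reg := Function.update σ.reg x c }
  | add x y z => { σ with reg := Function.update σ.reg x (σ.reg y + σ.reg z) }
  | sub x y z => { σ with reg := Function.update σ.reg x (σ.reg y - σ.reg z) }
  | load x y => { σ with reg := Function.update σ.reg x (σ.reg (σ.reg y)) }
  | store x y => { σ with reg := Function.update σ.reg (σ.reg x) (σ.reg y) }
  | fzero x => { σ with fld := Function.update σ.fld x 0 }
  | fone x => { σ with fld := Function.update σ.fld x 1 }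
  | fadd x y z => { σ with fld := Function.update σ.fld x (σ.fld y + σ.fld z) }
  | fsub x y z => { σ with fld := Function.update σ.fld x (σ.fld y - σ.fld z) }
  | fmul x y z => { σ with fld := Function.update σ.fld x (σ.fld y * σ.fld z) }
  | fload x y => { σ with fld := Function.update σ.fld x (σ.fld (σ.reg y)) }
  | fstore x y => { σ with fld := Function.update σ.fld (σ.reg x) (σ.fld y) }
  | felem x y => { σ with fld := Function.update σ.fld x (a (σ.reg y)) }
  | emit x => { σ with out := σ.out ++ [σ.fld x] }

/-- `Exec a p σ τ t`: started in the state `σ`, the program `p` halts in the state `τ` after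
exactly `t` steps, where every basic instruction and every test is one step. -/
inductive Exec (a : ℕ → K) : Prog → State K → State K → ℕ → Prop
  | instr (i : Instr) (σ : State K) : Exec a (.instr i) σ (i.step a σ) 1
  | seq {p q : Prog} {σ τ ρ : State K} {t u : ℕ} :
      Exec a p σ τ t → Exec a q τ ρ u → Exec a (.seq p q) σ ρ (t + u)
  | ite_ne {x : ℕ} {p q : Prog} {σ τ : State K} {t : ℕ} :
      σ.reg x ≠ 0 → Exec a p σ τ t → Exec a (.ite x p q) σ τ (t + 1)
  | ite_eq {x : ℕ} {p q : Prog} {σ τ : State K} {t : ℕ} :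
      σ.reg x = 0 → Exec a q σ τ t → Exec a (.ite x p q) σ τ (t + 1)
  | loop_ne {x : ℕ} {p : Prog} {σ τ ρ : State K} {t u : ℕ} :
      σ.reg x ≠ 0 → Exec a p σ τ t → Exec a (.loop x p) τ ρ u →
        Exec a (.loop x p) σ ρ (t + u + 1)
  | loop_eq {x : ℕ} {p : Prog} {σ : State K} :
      σ.reg x = 0 → Exec a (.loop x p) σ σ 1

/-- The start state: the input numbers are in the first registers, everything else is empty. -/
def start (input : List ℕ) : State K where
  reg := fun i => input.getD i 0
  fld := fun _ => 0
  out := []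

/-- On the given input, with the supply `a` of field elements, the program `A` halts after at most
`T` steps and has then written exactly the points of the list `pts`, one after the other,
coordinate by coordinate. -/
def Generates (A : Prog) (input : List ℕ) (a : ℕ → K) (T : ℕ) {n : ℕ}
    (pts : List (Fin n → K)) : Prop :=
  ∃ (σ : State K) (t : ℕ), Exec a A (start input) σ t ∧ t ≤ T ∧
    σ.out = (pts.map List.ofFn).flatten

end FieldRAM

/-- `ℓ = 1 + 2 min {⌈log₂ (w² s)⌉, μ}`. -/
def supportBound (w s μ : ℕ) : ℕ := 1 + 2 * min (Nat.clog 2 (w ^ 2 * s)) μ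

/-! The hitting set consists of all points reached from `(1, …, 1)` by boundedly many steps `p ↦ p +
a z * curve (a y)`, with `y, z < q`. At the parameter `a v` the curve is a nonzero multiple of the
`v`-th unit vector, so one step can imitate the change of one coordinate. Since `y` and `z` can be
chosen as common non-roots of univariate polynomials, one step does this for a whole finite family
of polynomials at once, each with its own coordinate (`exists_shift_eval_ne_zero`). Hence
polynomials that each become nonzero after changing at most `k` coordinates of `p` have a common
non-root `k` steps away (`exists_mem_reachSet`). It remains to show that few changes suffice.

A polynomial with at most `2 ^ r` monomials, or with at most `r` variables in every monomial,
becomes nonzero after changing at most `r` coordinates of any point without zero coordinates: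
constants are substituted one variable at a time, and a substitution that kills the polynomial
reveals so many coincidences among the monomials that `r` may be lowered by one
(`exists_eval_ne_zero_of_lowSupport`).

The determinants of the middle factors are of this kind with `w * r` in place of `r`, so `w * r`
steps lead to a point `α` at which all middle factors are invertible and no coordinate vanishes. Now
let the program be nonzero at `y`. By a rank argument (`card_lt_of_minimal`) it stays nonzero when
all blocks except fewer than `w` middle ones and the two ends are moved from `y` to `α`. On each
remaining block, with the other variables fixed, the value is a linear combination of the entries of
one factor, so `r` changes of `α` suffice there. This costs `(w + 1) * r` further steps, whatever
the order and partition of the variables.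

With `m` steps there are `(1 + q * q) ^ m` points, counted with repetition, where `q = O(n² δ w s)`
and `m = O(w * (r + 1))`. For `2 ≤ n` the factor `w` in `q` is absorbed by `w ≤ (n * δ * s) ^ w`,
which produces the exponent `w ^ 2`. For `n = 1` one step suffices and the width is replaced by 1.
An explicit program enumerates the points, and its time is bounded by loop invariants. -/

/-! ### Sparse polynomials and polynomials of small support -/

section LowSupport

open Finset MvPolynomial

/-- A set of exponent vectors that is small, or all of whose elements have small support. -/
def LowSupport {σ : Type*} (r : ℕ) (S : Finset (σ →₀ ℕ)) : Prop :=
  S.card ≤ 2 ^ r ∨ ∀ m ∈ S, m.support.card ≤ r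

theorem LowSupport.mono {σ : Type*} {r : ℕ} {S T : Finset (σ →₀ ℕ)} (h : LowSupport r T)
    (hST : S ⊆ T) : LowSupport r S :=
  h.imp (fun h => (card_le_card hST).trans h) fun h m hm => h m (hST hm)

variable {σ K : Type*} [Field K]

theorem exists_eval_ne_zero_of_degree_lt_card [Finite σ] {D : ℕ} {G : Finset K} (hG : D < G.card)
    {f : MvPolynomial σ K} (hf : f ≠ 0) (hD : ∀ m ∈ f.support, ∀ v, m v ≤ D) :
    ∃ x : σ → K, eval x f ≠ 0 := by
  by_contra! h
  refine hf (eq_zero_of_eval_zero_at_prod_finset f (fun _ => G) (fun v => ?_) fun x _ => h x)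
  refine lt_of_le_of_lt ?_ hG
  rw [degreeOf_le_iff]
  exact fun m hm => hD m hm v

/-- Substitution of a constant for one variable. -/
noncomputable def substVar (v : σ) (b : K) (f : MvPolynomial σ K) : MvPolynomial σ K :=
  ∑ m ∈ f.support, monomial (m.erase v) (f.coeff m * b ^ m v)

theorem eval_substVar [Fintype σ] [DecidableEq σ] (v : σ) (b : K) (f : MvPolynomial σ K)
    (x : σ → K) : eval x (substVar v b f) = eval (Function.update x v b) f := by
  rw [substVar, map_sum, eval_eq']
  refine sum_congr rfl fun m _ => ?_
  rw [eval_monomial, Finsupp.prod_fintype _ _ (fun _ => pow_zero _), mul_assoc]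
  congr 1
  rw [← mul_prod_erase univ (fun i => Function.update x v b i ^ m i) (mem_univ v),
    ← mul_prod_erase univ (fun i => x i ^ (m.erase v) i) (mem_univ v)]
  simp only [Function.update_self, Finsupp.erase_same, pow_zero, one_mul]
  congr 1
  refine prod_congr rfl fun i hi => ?_
  rw [Finsupp.erase_ne (ne_of_mem_erase hi), Function.update_of_ne (ne_of_mem_erase hi)]

theorem coeff_substVar [DecidableEq σ] (v : σ) (b : K) (f : MvPolynomial σ K) (e : σ →₀ ℕ) :
    (substVar v b f).coeff e =
      ∑ m ∈ f.support with m.erase v = e, f.coeff m * b ^ m v := by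
  rw [substVar, coeff_sum, sum_filter]
  exact sum_congr rfl fun m _ => coeff_monomial _ _ _

theorem support_substVar_subset [DecidableEq σ] (v : σ) (b : K) (f : MvPolynomial σ K) :
    (substVar v b f).support ⊆ f.support.image (Finsupp.erase v) := by
  intro e he
  rw [mem_support_iff, coeff_substVar] at he
  obtain ⟨m, hm, -⟩ := exists_ne_zero_of_sum_ne_zero he
  rw [mem_filter] at hm
  exact mem_image.2 ⟨m, hm⟩

/-- If substituting a nonzero constant makes `f` vanish, then no monomial of `f` is alone in its
class modulo the substituted variable. -/
theorem exists_ne_of_substVar_eq_zero [DecidableEq σ] {v : σ} {b : K} (hb : b ≠ 0)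
    {f : MvPolynomial σ K} (h : substVar v b f = 0) {m : σ →₀ ℕ} (hm : m ∈ f.support) :
    ∃ m' ∈ f.support, m'.erase v = m.erase v ∧ m' ≠ m := by
  by_contra! hne
  have hc := coeff_substVar v b f (m.erase v)
  rw [h, coeff_zero, sum_eq_single_of_mem m (by simpa using hm)] at hc
  · exact mul_ne_zero (mem_support_iff.1 hm) (pow_ne_zero _ hb) hc.symm
  · intro m' hm' hmm
    rw [mem_filter] at hm'
    exact absurd (hne m' hm'.1 hm'.2) hmm

/-- Every class modulo the exponent of `v` has at least two members, so there are at most half as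
many classes as monomials. Two members of a class differ at `v`, so one of them contains `v`, and
erasing `v` from it lowers its support below `r`. -/
theorem LowSupport.image_erase [DecidableEq σ] {r : ℕ} {S : Finset (σ →₀ ℕ)} {v : σ}
    (h : LowSupport r S) (hS : S.Nonempty)
    (hv : ∀ m ∈ S, ∃ m' ∈ S, m'.erase v = m.erase v ∧ m' ≠ m) :
    ∃ q, r = q + 1 ∧ LowSupport q (S.image (Finsupp.erase v)) := by
  have hv' : ∀ m ∈ S, ∃ m' ∈ S, m'.erase v = m.erase v ∧ m' v ≠ 0 := by
    intro m hm
    obtain ⟨m', hm', he, hne⟩ := hv m hm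
    by_cases h0 : m' v = 0
    · refine ⟨m, hm, rfl, fun h1 => hne ?_⟩
      ext u
      by_cases huv : u = v
      · rw [huv, h0, h1]
      · have := DFunLike.congr_fun he u
        rwa [Finsupp.erase_ne huv, Finsupp.erase_ne huv] at this
    · exact ⟨m', hm', he, h0⟩
  rcases h with h | h
  · have h2 : (S.image (Finsupp.erase v)).card * 2 ≤ S.card := by
      rw [card_eq_sum_card_image (Finsupp.erase v) S]
      rw [← smul_eq_mul]
      refine card_nsmul_le_sum _ _ _ fun e he => ?_
      obtain ⟨m, hm, rfl⟩ := mem_image.1 he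
      obtain ⟨m', hm', he', hne⟩ := hv m hm
      refine one_lt_card.2 ⟨m', ?_, m, ?_, hne⟩ <;> simp [hm, hm', he']
    have h3 : 0 < (S.image (Finsupp.erase v)).card := (hS.image _).card_pos
    cases r with
    | zero => simp at h; omega
    | succ q => exact ⟨q, rfl, Or.inl (by rw [pow_succ] at h; omega)⟩
  · have key : ∀ m ∈ S, (m.erase v).support.card + 1 ≤ r := by
      intro m hm
      obtain ⟨m', hm', he, hne⟩ := hv' m hm
      rw [← he, Finsupp.support_erase, card_erase_add_one (Finsupp.mem_support_iff.2 hne)]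
      exact h m' hm'
    obtain ⟨m, hm⟩ := hS
    cases r with
    | zero => exact absurd (key m hm) (by omega)
    | succ q =>
      refine ⟨q, rfl, Or.inr fun e he => ?_⟩
      obtain ⟨m, hm, rfl⟩ := mem_image.1 he
      exact Nat.le_of_succ_le_succ (key m hm)

/-- Induction on the set `V` of variables that may occur. Each variable `v` either keeps the value
`α v`, or that value kills the polynomial, and then the drop of `r` pays for another value. -/
theorem exists_eval_ne_zero_of_lowSupport_of_subset [Fintype σ] [DecidableEq σ] [DecidableEq K]
    {D : ℕ} {G : Finset K} (hG : D < G.card) {α : σ → K} (hα : ∀ v, α v ≠ 0) (V : Finset σ) :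
    ∀ (r : ℕ) (f : MvPolynomial σ K), f ≠ 0 → (∀ m ∈ f.support, m.support ⊆ V) →
      (∀ m ∈ f.support, ∀ v, m v ≤ D) → LowSupport r f.support →
      ∃ x : σ → K, eval x f ≠ 0 ∧ #{v | x v ≠ α v} ≤ r := by
  induction V using Finset.induction_on with
  | empty =>
    intro r f hf hV hD hr
    obtain ⟨y, hy⟩ := exists_eval_ne_zero_of_degree_lt_card hG hf hD
    refine ⟨α, ?_, by simp⟩
    rw [eval_eq'] at hy ⊢
    convert hy using 4 with m hm
    have : m = 0 := by simpa using hV m hm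
    simp [this]
  | insert v V hvV ih =>
    intro r f hf hV hD hr
    have hVb : ∀ b, ∀ m ∈ (substVar v b f).support, m.support ⊆ V := by
      intro b m hm
      obtain ⟨m', hm', rfl⟩ := mem_image.1 (support_substVar_subset v b f hm)
      rw [Finsupp.support_erase, ← erase_insert hvV]
      exact erase_subset_erase _ (hV m' hm')
    have hDb : ∀ b, ∀ m ∈ (substVar v b f).support, ∀ u, m u ≤ D := by
      intro b m hm u
      obtain ⟨m', hm', rfl⟩ := mem_image.1 (support_substVar_subset v b f hm)
      by_cases huv : u = v
      · simp [huv]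
      · rw [Finsupp.erase_ne huv]; exact hD m' hm' u
    -- If `α v` fails, the coordinate of some non-root `y` is used instead. The monomials left after
    -- erasing `v` do not depend on the value substituted, so the bound gained from the failure of
    -- `α v` also holds for `y v`.
    by_cases h0 : substVar v (α v) f = 0
    · obtain ⟨q, rfl, hq⟩ := hr.image_erase (support_nonempty.2 hf)
        fun m hm => exists_ne_of_substVar_eq_zero (hα v) h0 hm
      obtain ⟨y, hy⟩ := exists_eval_ne_zero_of_degree_lt_card hG hf hD
      have hne : substVar v (y v) f ≠ 0 := by
        intro h
        have := eval_substVar v (y v) f y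
        rw [h, map_zero, Function.update_eq_self] at this
        exact hy this.symm
      obtain ⟨x, hx, hc⟩ := ih q _ hne (hVb _) (hDb _) (hq.mono (support_substVar_subset v _ f))
      refine ⟨Function.update x v (y v), by rwa [eval_substVar] at hx, ?_⟩
      refine (card_le_card (t := insert v ({u | x u ≠ α u} : Finset σ)) fun u hu => ?_).trans
        ((card_insert_le _ _).trans (Nat.succ_le_succ hc))
      by_cases huv : u = v
      · simp [huv]
      · simpa [huv] using hu
    · have hlow : LowSupport r (substVar v (α v) f).support := by
        refine LowSupport.mono (T := f.support.image (Finsupp.erase v)) ?_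
          (support_substVar_subset v _ f)
        refine hr.imp (fun h => card_image_le.trans h) fun h m hm => ?_
        obtain ⟨m', hm', rfl⟩ := mem_image.1 hm
        rw [Finsupp.support_erase]
        exact (card_erase_le).trans (h m' hm')
      obtain ⟨x, hx, hc⟩ := ih r _ h0 (hVb _) (hDb _) hlow
      refine ⟨Function.update x v (α v), by rwa [eval_substVar] at hx, ?_⟩
      refine (card_le_card fun u hu => ?_).trans hc
      by_cases huv : u = v
      · simp [huv] at hu
      · simpa [huv] using hu

/-- A polynomial whose set of monomials is small, or consists of monomials with few variables, can
be made nonzero by changing few coordinates of any point with nonzero coordinates. -/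
theorem exists_eval_ne_zero_of_lowSupport [Fintype σ] [DecidableEq σ] [DecidableEq K] {D r : ℕ}
    {G : Finset K} (hG : D < G.card) {α : σ → K} (hα : ∀ v, α v ≠ 0) {f : MvPolynomial σ K}
    (hf : f ≠ 0) (hD : ∀ m ∈ f.support, ∀ v, m v ≤ D) (hr : LowSupport r f.support) :
    ∃ x : σ → K, eval x f ≠ 0 ∧ #{v | x v ≠ α v} ≤ r :=
  exists_eval_ne_zero_of_lowSupport_of_subset hG hα univ r f hf (fun _ _ => subset_univ _) hD hr

end LowSupport

/-! ### Imitating changes of single coordinates by steps along a curve -/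

section CurveShift

open Finset

variable {K : Type*} [Field K]

/-- A polynomial curve in the parameter `y` through multiples of all unit vectors: it meets the
`i`-th axis for `y = a i`. -/
def curve (a : ℕ → K) (n : ℕ) (y : K) (i : Fin n) : K :=
  ∏ j ∈ (range n).erase i, (y - a j)

/-- The points reached from `(1, …, 1)` by at most `k` steps along multiples of points of the
curve, with the parameters among `a 0, …, a (q - 1)`. -/
def reachSet (a : ℕ → K) (n q : ℕ) : ℕ → Set (Fin n → K)
  | 0 => {fun _ => 1}
  | k + 1 => reachSet a n q k ∪
      {x | ∃ p ∈ reachSet a n q k, ∃ y < q, ∃ z < q, x = fun i => p i + a z * curve a n (a y) i}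

theorem reachSet_mono (a : ℕ → K) (n q : ℕ) : Monotone (reachSet a n q) :=
  monotone_nat_of_le_succ fun _ => Set.subset_union_left

theorem exists_eval_ne_zero_of_natDegree_lt {a : ℕ → K} {q : ℕ} (ha : Set.InjOn a (Set.Iio q))
    {g : Polynomial K} (hg : g ≠ 0) (hd : g.natDegree < q) : ∃ y < q, g.eval (a y) ≠ 0 := by
  classical
  by_contra! h
  refine hg (Polynomial.eq_zero_of_natDegree_lt_card_of_eval_eq_zero' g ((range q).image a)
    (fun i hi => ?_) ?_)
  · obtain ⟨y, hy, rfl⟩ := mem_image.1 hi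
    exact h y (mem_range.1 hy)
  · rw [card_image_of_injOn (by simpa [Set.InjOn] using ha), card_range]
    exact hd

theorem exists_forall_eval_ne_zero {ι : Type*} {a : ℕ → K} {q : ℕ}
    (ha : Set.InjOn a (Set.Iio q)) (I : Finset ι) (g : ι → Polynomial K) (hg : ∀ i ∈ I, g i ≠ 0)
    (hd : ∑ i ∈ I, (g i).natDegree < q) : ∃ y < q, ∀ i ∈ I, (g i).eval (a y) ≠ 0 := by
  obtain ⟨y, hy, h⟩ := exists_eval_ne_zero_of_natDegree_lt ha (prod_ne_zero_iff.2 hg)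
    ((Polynomial.natDegree_prod_le _ _).trans_lt hd)
  rw [Polynomial.eval_prod] at h
  exact ⟨y, hy, prod_ne_zero_iff.1 h⟩

theorem curve_self_ne_zero {a : ℕ → K} {n q : ℕ} (ha : Set.InjOn a (Set.Iio q)) (hn : n ≤ q)
    (v : Fin n) : curve a n (a v) v ≠ 0 := by
  refine prod_ne_zero_iff.2 fun j hj h => ?_
  rw [mem_erase, mem_range] at hj
  exact hj.1 (ha (Set.mem_Iio.2 (hj.2.trans_le hn)) (Set.mem_Iio.2 (v.2.trans_le hn))
    (sub_eq_zero.1 h).symm)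

theorem curve_of_ne {a : ℕ → K} {n : ℕ} {u v : Fin n} (h : u ≠ v) : curve a n (a v) u = 0 := by
  refine prod_eq_zero (i := (v : ℕ)) ?_ (sub_self _)
  rw [mem_erase, mem_range]
  exact ⟨fun h' => h (Fin.ext h'.symm), v.2⟩

/-- For each `i` alone, a multiple of the curve point at `a (v i)` leads back to `x i`, a non-root.
So the polynomials in the curve parameter are nonzero and have a common non-root `y`; after that the
same argument applies to the multiplier. -/
theorem exists_shift_eval_ne_zero {ι : Type*} {a : ℕ → K} {n q : ℕ}
    (ha : Set.InjOn a (Set.Iio q)) (hn : n ≤ q) (hn1 : 1 ≤ n) (I : Finset ι)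
    (f : ι → MvPolynomial (Fin n) K) (hq : n * ∑ i ∈ I, (f i).totalDegree < q)
    (p : Fin n → K) (x : ι → Fin n → K) (v : ι → Fin n)
    (hx : ∀ i ∈ I, MvPolynomial.eval (x i) (f i) ≠ 0) :
    ∃ y < q, ∃ z < q, ∀ i ∈ I, MvPolynomial.eval (fun u =>
      Function.update (x i) (v i) (p (v i)) u + a z * curve a n (a y) u) (f i) ≠ 0 := by
  have hsum : ∑ i ∈ I, (f i).totalDegree * n < q := by rwa [← sum_mul, mul_comm]
  set x' : ι → Fin n → K := fun i => Function.update (x i) (v i) (p (v i)) with hx'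
  -- The multiplier that carries the coordinate `p (v i)` back to `x i (v i)` when the parameter is
  -- `a (v i)`.
  let c : ι → K := fun i => (x i (v i) - p (v i)) / curve a n (a (v i)) (v i)
  let g : ι → Polynomial K := fun i => MvPolynomial.aeval (fun u : Fin n =>
    Polynomial.C (x' i u) + Polynomial.C (c i) *
      ∏ j ∈ (range n).erase u, (Polynomial.X - Polynomial.C (a j))) (f i)
  have hg : ∀ i y, (g i).eval y =
      MvPolynomial.eval (fun u => x' i u + c i * curve a n y u) (f i) := by
    intro i y
    rw [← Polynomial.coe_evalRingHom, MvPolynomial.map_aeval, MvPolynomial.eval]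
    congr 1
    congr 1
    · ext; simp
    · funext u
      simp [curve, Polynomial.eval_prod]
  have hgd : ∀ i, (g i).natDegree ≤ (f i).totalDegree * n := by
    intro i
    refine MvPolynomial.aeval_natDegree_le _ le_rfl _ fun u => ?_
    refine (Polynomial.natDegree_C_add).le.trans ((Polynomial.natDegree_C_mul_le _ _).trans ?_)
    refine (Polynomial.natDegree_prod_le _ _).trans ?_
    simp [card_erase_of_mem]
  obtain ⟨y, hy, hgy⟩ := exists_forall_eval_ne_zero ha I g (fun i hi h0 => by
    have h1 := hg i (a (v i))
    rw [h0, Polynomial.eval_zero] at h1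
    refine hx i hi ?_
    rw [h1]
    congr 2
    funext u
    by_cases hu : u = v i
    · subst hu
      simp only [hx', Function.update_self, c]
      rw [div_mul_cancel₀ _ (curve_self_ne_zero ha hn _)]
      ring
    · simp [hx', Function.update_of_ne hu, curve_of_ne hu])
    ((sum_le_sum fun i _ => hgd i).trans_lt hsum)
  -- The multipliers `c i` still depend on `i`. With `y` fixed, the multiplier becomes the
  -- indeterminate; nonvanishing at `c i` shows `h i ≠ 0`.
  let h : ι → Polynomial K := fun i => MvPolynomial.aeval (fun u : Fin n =>
    Polynomial.C (x' i u) + Polynomial.C (curve a n (a y) u) * Polynomial.X) (f i)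
  have hh : ∀ i z, (h i).eval z =
      MvPolynomial.eval (fun u => x' i u + z * curve a n (a y) u) (f i) := by
    intro i z
    rw [← Polynomial.coe_evalRingHom, MvPolynomial.map_aeval, MvPolynomial.eval]
    congr 1
    congr 1
    · ext; simp
    · funext u
      simp [mul_comm z]
  have hhd : ∀ i, (h i).natDegree ≤ (f i).totalDegree * n := by
    intro i
    refine (MvPolynomial.aeval_natDegree_le (n := 1) _ le_rfl _ fun u => ?_).trans
      (Nat.mul_le_mul_left _ hn1)
    exact (Polynomial.natDegree_C_add).le.trans ((Polynomial.natDegree_C_mul_le _ _).trans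
      Polynomial.natDegree_X_le)
  obtain ⟨z, hz, hhz⟩ := exists_forall_eval_ne_zero ha I h (fun i hi h0 => by
    have h1 := hh i (c i)
    rw [h0, Polynomial.eval_zero, ← hg] at h1
    exact hgy i hi h1.symm)
    ((sum_le_sum fun i _ => hhd i).trans_lt hsum)
  exact ⟨y, hy, z, hz, fun i hi => by rw [← hh]; exact hhz i hi⟩

/-- If each polynomial of a family has a non-root that differs from `p` in at most `k`
coordinates, then they have a common non-root reached from `p` by `k` steps along the curve. -/
theorem exists_mem_reachSet {ι : Type*} {a : ℕ → K} {n q : ℕ}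
    (ha : Set.InjOn a (Set.Iio q)) (hn : n ≤ q) (hn1 : 1 ≤ n) (I : Finset ι)
    (f : ι → MvPolynomial (Fin n) K) (hq : n * ∑ i ∈ I, (f i).totalDegree < q) (k : ℕ) :
    ∀ (l : ℕ) (p : Fin n → K), p ∈ reachSet a n q l →
      (∀ i ∈ I, ∃ x : Fin n → K, MvPolynomial.eval x (f i) ≠ 0 ∧
        Set.ncard {u | x u ≠ p u} ≤ k) →
      ∃ p' ∈ reachSet a n q (l + k), ∀ i ∈ I, MvPolynomial.eval p' (f i) ≠ 0 := by
  induction k with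
  | zero =>
    intro l p hp h
    refine ⟨p, hp, fun i hi => ?_⟩
    obtain ⟨x, hx, hc⟩ := h i hi
    rw [Nat.le_zero, Set.ncard_eq_zero, Set.eq_empty_iff_forall_notMem] at hc
    have : x = p := funext fun u => not_not.1 (hc u)
    rwa [← this]
  | succ k ih =>
    intro l p hp h
    -- A coordinate is selected in which the non-root differs from `p`, or an arbitrary one if there
    -- is none; resetting it to that of `p` leaves at most `k` differences.
    have h' : ∀ i, ∃ x : Fin n → K, ∃ v : Fin n, i ∈ I → (MvPolynomial.eval x (f i) ≠ 0 ∧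
        Set.ncard {u | Function.update x v (p v) u ≠ p u} ≤ k) := by
      intro i
      by_cases hi : i ∈ I
      · obtain ⟨x, hx, hc⟩ := h i hi
        by_cases hv : ∃ v, x v ≠ p v
        · obtain ⟨v, hv⟩ := hv
          refine ⟨x, v, fun _ => ⟨hx, ?_⟩⟩
          have hsub : {u | Function.update x v (p v) u ≠ p u} ⊆ {u | x u ≠ p u} \ {v} := by
            intro u hu
            by_cases huv : u = v
            · subst huv; simp at hu
            · exact ⟨by simpa [huv] using hu, huv⟩
          refine (Set.ncard_le_ncard hsub).trans ?_
          rw [Set.ncard_sdiff_singleton_of_mem hv]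
          omega
        · push Not at hv
          refine ⟨x, ⟨0, hn1⟩, fun _ => ⟨hx, ?_⟩⟩
          rw [← hv ⟨0, hn1⟩, Function.update_eq_self]
          simp [hv]
      · exact ⟨p, ⟨0, hn1⟩, fun h => absurd h hi⟩
    choose x v hxv using h'
    obtain ⟨y, hy, z, hz, hyz⟩ := exists_shift_eval_ne_zero ha hn hn1 I f hq p x v
      fun i hi => (hxv i hi).1
    -- The point `p` and the reset points are all translated by the same vector, which preserves the
    -- number of differing coordinates.
    obtain ⟨p', hp', h⟩ := ih (l + 1) (fun u => p u + a z * curve a n (a y) u)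
      (Or.inr ⟨p, hp, y, hy, z, hz, rfl⟩) fun i hi => ⟨_, hyz i hi, by
        simpa using (hxv i hi).2⟩
    exact ⟨p', by rwa [show l + (k + 1) = l + 1 + k by omega], h⟩

end CurveShift

/-! ### Rank argument: few factors need to be kept -/

section MinimalBlocks

open Finset Matrix

variable {K : Type*} [Field K]

/-- The value of a product of matrices between a row and a column vector, where the factors with
an index in `J` are taken from `A` and the others from `E`. -/
def mixedValue {w d : ℕ} (l r : Fin w → K) (A E : Fin d → Matrix (Fin w) (Fin w) K)
    (J : Finset (Fin d)) : K :=
  l ⬝ᵥ ((List.ofFn fun i => if i ∈ J then A i else E i).prod *ᵥ r)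

theorem det_prod_ne_zero {w : ℕ} (L : List (Matrix (Fin w) (Fin w) K))
    (h : ∀ A ∈ L, A.det ≠ 0) : L.prod.det ≠ 0 := by
  induction L with
  | nil => simp
  | cons A L ih =>
    rw [List.prod_cons, det_mul]
    exact mul_ne_zero (h A (by simp)) (ih fun B hB => h B (by simp [hB]))

/-- This identifies the entries of the matrix product in `card_lt_of_minimal` as mixed values. -/
theorem take_append_take_drop_append_drop {α : Type*} {d : ℕ} (A E : Fin d → α)
    (J : Finset (Fin d)) {p p' : ℕ} (hp : p ≤ p') (hp' : p' ≤ d) :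
    (List.ofFn fun i => if i ∈ J then A i else E i).take p ++
      (((List.ofFn E).drop p).take (p' - p) ++
        (List.ofFn fun i => if i ∈ J then A i else E i).drop p') =
    List.ofFn fun i => if i ∈ ({j ∈ J | ¬(p ≤ (j : ℕ) ∧ (j : ℕ) < p')} : Finset (Fin d))
      then A i else E i := by
  refine List.ext_getElem (by simp; omega) fun k h1 h2 => ?_
  simp only [List.length_ofFn] at h2
  simp only [List.getElem_append, List.length_take, List.length_drop, List.length_ofFn,
    List.getElem_take, List.getElem_drop, List.getElem_ofFn, mem_filter]
  split_ifs with h3 h4 h5 h5 h6 h7 h8 h9 h10 <;>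
    first
    | rfl
    | (exfalso; omega)
    | skip
  all_goals
    have e1 : p' + (k - min p d - min (p' - p) (d - p)) = k ∨ k < p' := by omega
    have e2 : p + (k - min p d) = k ∨ k < p := by omega
    grind

/-- Minimality makes a square matrix of size `J.card + 1` triangular with nonzero diagonal. It
factors through dimension `w`, so `J.card + 1 ≤ w`. -/
theorem card_lt_of_minimal {w d : ℕ} (l r : Fin w → K) (A E : Fin d → Matrix (Fin w) (Fin w) K)
    (hE : ∀ i, (E i).det ≠ 0) (J : Finset (Fin d)) (hJ : mixedValue l r A E J ≠ 0)
    (hmin : ∀ J' ⊂ J, mixedValue l r A E J' = 0) : J.card < w := by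
  set Lm := List.ofFn fun i => if i ∈ J then A i else E i with hLm
  set Le := List.ofFn E with hLe
  -- The positions at which the product is cut: just before each factor of `J`, and at the very end.
  let P : Finset (Fin (d + 1)) := insert (Fin.last d) (J.map Fin.castSuccEmb)
  have hP : P.card = J.card + 1 := by
    rw [card_insert_of_notMem, card_map]
    simp [Fin.castSucc_ne_last]
  -- Row `p` uses `E` throughout after the cut `p`, and column `p'` cancels the factors of `E` after
  -- `p'`. So for `p ≤ p'` only the factors in `[p, p')` are replaced by those of `E`.
  let V : Matrix P (Fin w) K := of fun p => l ᵥ* ((Lm.take p).prod * (Le.drop p).prod)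
  let S : Matrix (Fin w) P K := of fun k p =>
    (((Le.drop p).prod)⁻¹ *ᵥ ((Lm.drop p).prod *ᵥ r)) k
  have hVS : ∀ p p' : P, p ≤ p' → (V * S) p p' = mixedValue l r A E
      {j ∈ J | ¬((p : ℕ) ≤ (j : ℕ) ∧ (j : ℕ) < (p' : ℕ))} := by
    intro p p' h
    have hle : ((p : Fin (d + 1)) : ℕ) ≤ (p' : Fin (d + 1)) := h
    have hdet : IsUnit ((Le.drop p').prod).det := by
      refine isUnit_iff_ne_zero.2 (det_prod_ne_zero _ fun B hB => ?_)
      have := List.mem_of_mem_drop hB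
      rw [hLe, List.mem_ofFn'] at this
      obtain ⟨i, rfl⟩ := this
      exact hE i
    have hsplit : (Le.drop p).prod =
        ((Le.drop p).take ((p' : Fin (d + 1)) - (p : Fin (d + 1)) : ℕ)).prod *
          (Le.drop p').prod := by
      conv_lhs => rw [← List.take_append_drop
        ((p' : Fin (d + 1)) - (p : Fin (d + 1)) : ℕ) (Le.drop p), List.prod_append,
        List.drop_drop, Nat.add_sub_cancel' hle]
    rw [mixedValue, ← take_append_take_drop_append_drop A E J hle (Fin.is_le _), ← hLm, ← hLe,
      List.prod_append, List.prod_append]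
    change (l ᵥ* ((Lm.take p).prod * (Le.drop p).prod)) ⬝ᵥ
      (((Le.drop p').prod)⁻¹ *ᵥ ((Lm.drop p').prod *ᵥ r)) = _
    rw [hsplit, ← dotProduct_mulVec, mulVec_mulVec, mulVec_mulVec]
    congr 2
    simp only [mul_assoc]
    rw [← mul_assoc (Le.drop p').prod, mul_nonsing_inv _ hdet, one_mul]
  have hdet : (V * S).det ≠ 0 := by
    rw [det_of_isLowerTriangular]
    · refine prod_ne_zero_iff.2 fun p _ => ?_
      rw [hVS p p le_rfl, filter_true_of_mem]
      · exact hJ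
      · intro j _; omega
    · intro p p' h
      have h' : p < p' := h
      rw [hVS p p' h'.le]
      -- A cut `p < p'` is not the last one, so it comes from an element of `J`, and that element
      -- lies in the removed interval `[p, p')`.
      refine hmin _ (filter_ssubset.2 ?_)
      have hp := p.2
      rcases mem_insert.1 hp with hp | hp
      · exact absurd (lt_of_lt_of_le h' (by
          change (p' : Fin (d + 1)) ≤ p; rw [hp]; exact Fin.le_last _)) (lt_irrefl _)
      · obtain ⟨j, hj, hjp⟩ := mem_map.1 hp
        refine ⟨j, hj, not_not.2 ⟨?_, ?_⟩⟩
        · rw [← hjp]; simp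
        · have h2 : (p : Fin (d + 1)) < p' := h'
          rw [← hjp] at h2
          exact h2
  have hrank := rank_of_isUnit (V * S) ((isUnit_iff_isUnit_det _).2 (isUnit_iff_ne_zero.2 hdet))
  have h1 := (rank_mul_le_left V S).trans (rank_le_card_width V)
  rw [hrank, Fintype.card_coe, Fintype.card_fin, hP] at h1
  omega

end MinimalBlocks

/-! ### Hitting a program: invertible point, few blocks, few coordinates -/

section BlockReduction

open Finset MvPolynomial

variable {K : Type*} [Field K]

theorem eval_eq_of_mem_supported {σ : Type*} {V : Set σ} {f : MvPolynomial σ K}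
    (hf : f ∈ supported K V) {x y : σ → K} (h : ∀ v ∈ V, x v = y v) : eval x f = eval y f :=
  hom_congr_vars (f₁ := eval x) (f₂ := eval y) (by ext; simp)
    (fun v hv _ => by simpa using h v (mem_supported.1 hf hv)) rfl

theorem support_subset_of_mem_supported {σ : Type*} {V : Set σ} {f : MvPolynomial σ K}
    (hf : f ∈ supported K V) {m : σ →₀ ℕ} (hm : m ∈ f.support) {v : σ} (hv : v ∈ m.support) :
    v ∈ V :=
  mem_supported.1 hf (mem_coe.2 (mem_vars_iff_degreeOf_ne_zero.2 (by
    have h1 := monomial_le_degreeOf v hm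
    have h2 := Finsupp.mem_support_iff.1 hv
    omega)))

theorem totalDegree_le_card_mul {σ : Type*} {f : MvPolynomial σ K} {V : Finset σ} {D : ℕ}
    (hV : ∀ m ∈ f.support, m.support ⊆ V) (hD : ∀ m ∈ f.support, ∀ v, m v ≤ D) :
    f.totalDegree ≤ V.card * D := by
  refine Finset.sup_le fun m hm => ?_
  calc m.sum (fun _ e => e) ≤ ∑ v ∈ V, m v :=
        sum_le_sum_of_subset (f := fun v => m v) (hV m hm)
    _ ≤ V.card * D := by
        rw [← smul_eq_mul]; exact sum_le_card_nsmul _ _ _ fun v _ => hD m hm v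

theorem exists_sum_of_mem_support_prod {σ ι : Type*} [DecidableEq ι] (t : Finset ι)
    (p : ι → MvPolynomial σ K) :
    ∀ m ∈ (∏ i ∈ t, p i).support, ∃ g : ι → σ →₀ ℕ,
      (∀ i ∈ t, g i ∈ (p i).support) ∧ m = ∑ i ∈ t, g i := by
  classical
  induction t using Finset.induction_on with
  | empty =>
    intro m hm
    refine ⟨0, by simp, ?_⟩
    rw [prod_empty, mem_support_iff, coeff_one] at hm
    by_contra h
    exact hm (if_neg (fun h' => h (by simp [← h'])))
  | insert i t hi ih =>
    intro m hm
    rw [prod_insert hi] at hm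
    obtain ⟨m₁, h₁, m₂, h₂, rfl⟩ := mem_add.1 (support_mul _ _ hm)
    obtain ⟨g, hg, rfl⟩ := ih m₂ h₂
    refine ⟨Function.update g i m₁, fun j hj => ?_, ?_⟩
    · by_cases hji : j = i
      · subst hji; simpa using h₁
      · rw [Function.update_of_ne hji]
        exact hg j ((mem_insert.1 hj).resolve_left hji)
    · rw [sum_insert hi, Function.update_self]
      congr 1
      refine sum_congr rfl fun j hj => ?_
      rw [Function.update_of_ne fun h : j = i => hi (h ▸ hj)]

theorem exists_sum_of_mem_support_det {σ : Type*} {w : ℕ}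
    (A : Matrix (Fin w) (Fin w) (MvPolynomial σ K)) {S : Finset (σ →₀ ℕ)}
    (hS : ∀ k l, (A k l).support ⊆ S) {m : σ →₀ ℕ} (hm : m ∈ A.det.support) :
    ∃ g : Fin w → σ →₀ ℕ, (∀ i, g i ∈ S) ∧ m = ∑ i, g i := by
  classical
  rw [Matrix.det_apply] at hm
  obtain ⟨τ, -, hτ⟩ := mem_biUnion.1 (support_sum hm)
  have hτ' : m ∈ (∏ i, A (τ i) i).support := by
    rcases Int.units_eq_one_or (Equiv.Perm.sign τ) with h | h <;> rw [h] at hτ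
    · simpa using hτ
    · simpa using hτ
  obtain ⟨g, hg, hm⟩ := exists_sum_of_mem_support_prod univ _ m hτ'
  exact ⟨g, fun i => hS _ _ (hg i (mem_univ i)), hm⟩

/-- By the Leibniz formula a monomial of the determinant is a sum of `w` exponent vectors from `S`,
which leaves at most `S.card ^ w` of them and at most `w * r` variables in each. -/
theorem lowSupport_support_det {σ : Type*} {w r : ℕ}
    (A : Matrix (Fin w) (Fin w) (MvPolynomial σ K)) {S : Finset (σ →₀ ℕ)}
    (hS : ∀ k l, (A k l).support ⊆ S) (hr : LowSupport r S) :
    LowSupport (w * r) A.det.support := by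
  classical
  rcases hr with hr | hr
  · left
    calc A.det.support.card
        ≤ ((Fintype.piFinset fun _ : Fin w => S).image fun g => ∑ i, g i).card := by
          refine card_le_card fun m hm => ?_
          obtain ⟨g, hg, rfl⟩ := exists_sum_of_mem_support_det A hS hm
          exact mem_image.2 ⟨g, Fintype.mem_piFinset.2 hg, rfl⟩
      _ ≤ S.card ^ w := card_image_le.trans (by simp)
      _ ≤ (2 ^ r) ^ w := Nat.pow_le_pow_left hr _
      _ = 2 ^ (w * r) := by rw [← pow_mul, mul_comm]
  · right
    intro m hm
    obtain ⟨g, hg, rfl⟩ := exists_sum_of_mem_support_det A hS hm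
    calc (∑ i, g i).support.card ≤ (univ.biUnion fun i => (g i).support).card :=
          card_le_card Finsupp.support_finsetSum
      _ ≤ ∑ i, (g i).support.card := card_biUnion_le
      _ ≤ ∑ _i : Fin w, r := sum_le_sum fun i _ => hr _ (hg i)
      _ = w * r := by simp

theorem totalDegree_prod_ofFn_le {σ : Type*} {w : ℕ} : ∀ {d : ℕ}
    (A : Fin d → Matrix (Fin w) (Fin w) (MvPolynomial σ K)) (t : Fin d → ℕ),
    (∀ i k l, (A i k l).totalDegree ≤ t i) →
    ∀ k l, ((List.ofFn A).prod k l).totalDegree ≤ ∑ i, t i := by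
  intro d
  induction d with
  | zero =>
    intro A t _ k l
    simp only [List.ofFn_zero, List.prod_nil, Matrix.one_apply]
    split_ifs <;> simp
  | succ d ih =>
    intro A t h k l
    rw [List.ofFn_succ, List.prod_cons, Matrix.mul_apply, Fin.sum_univ_succ]
    refine totalDegree_finsetSum_le fun j _ => (totalDegree_mul _ _).trans ?_
    exact add_le_add (h 0 k j) (ih (fun i => A i.succ) (fun i => t i.succ)
      (fun i => h i.succ) j l)

theorem list_ofFn_update {α : Type*} {d : ℕ} (f : Fin d → α) (i : Fin d) (b : α) :
    List.ofFn (Function.update f i b) = (List.ofFn f).set i b := by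
  refine List.ext_getElem (by simp) fun k h1 h2 => ?_
  rw [List.getElem_set, List.getElem_ofFn]
  split_ifs with h
  · subst h; simp
  · rw [Function.update_of_ne (fun h' => h (by rw [← h'])), List.getElem_ofFn]

theorem lt_of_mul_mul_add_lt {n A q : ℕ} (hn : 1 ≤ n) (h : n * (n * A + n) < q) :
    n ≤ q ∧ A < q ∧ n * (n * A) < q := by
  have h1 : n * A + n ≤ n * (n * A + n) := Nat.le_mul_of_pos_left _ hn
  have h2 : A ≤ n * A := Nat.le_mul_of_pos_left _ hn
  rw [mul_add] at h h1
  have h3 : n ≤ n * n := Nat.le_mul_of_pos_left _ hn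
  omega

namespace InvROABP

variable {n w : ℕ} (B : InvROABP K n w)

theorem eval_poly (x : Fin n → K) : eval x B.poly = (fun k => eval x (B.left k)) ⬝ᵥ
    ((List.ofFn fun i => (B.mid i).map (eval x)).prod.mulVec fun k => eval x (B.right k)) := by
  rw [poly, RingHom.map_dotProduct]
  congr 1
  funext k
  rw [Function.comp_apply, RingHom.map_mulVec]
  have : (List.ofFn B.mid).prod.map (eval x) =
      (List.ofFn fun i => (B.mid i).map (eval x)).prod := by
    have h := map_list_prod ((eval x).mapMatrix (m := Fin w)) (List.ofFn B.mid)
    rw [List.map_ofFn] at h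
    exact h
  rw [this]
  rfl

theorem support_subset_monomials {ι : Type*} [Fintype ι] (A : ι → MvPolynomial (Fin n) K)
    (i : ι) : (A i).support ⊆ monomials A := by
  classical
  intro m hm
  rw [monomials, mem_biUnion]
  exact ⟨i, mem_univ i, hm⟩

theorem support_sum_smul_subset_monomials {ι : Type*} [Fintype ι]
    (A : ι → MvPolynomial (Fin n) K) (c : ι → K) :
    (∑ i, c i • A i).support ⊆ monomials A := by
  classical
  intro m hm
  obtain ⟨i, -, hi⟩ := mem_biUnion.1 (support_sum hm)
  exact support_subset_monomials A i (support_smul hi)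

theorem eval_left_mix (x y : Fin n → K) (k : Fin w) {P : Fin n → Prop} [DecidablePred P]
    (hP : ∀ v, B.block v = 0 → P v) :
    eval (fun v => if P v then y v else x v) (B.left k) = eval y (B.left k) :=
  eval_eq_of_mem_supported (B.left_mem k) fun v hv => if_pos (hP v hv)

theorem eval_right_mix (x y : Fin n → K) (k : Fin w) {P : Fin n → Prop} [DecidablePred P]
    (hP : ∀ v, B.block v = Fin.last _ → P v) :
    eval (fun v => if P v then y v else x v) (B.right k) = eval y (B.right k) :=
  eval_eq_of_mem_supported (B.right_mem k) fun v hv => if_pos (hP v hv)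

theorem map_eval_mid_congr {x y : Fin n → K} (i : Fin B.d)
    (h : ∀ v, B.block v = i.castSucc.succ → x v = y v) :
    (B.mid i).map (eval x) = (B.mid i).map (eval y) := by
  ext k l
  exact eval_eq_of_mem_supported (B.mid_mem i k l) h

/-- As a function of the variables of one block, the polynomial of a program is a linear
combination of the entries of the factor of that block. -/
theorem exists_eval_block {Q : Finset (Fin n →₀ ℕ) → Prop} (hQ : B.EachFactor Q)
    (b : Fin (B.d + 2)) (x : Fin n → K) :
    ∃ S, Q S ∧ ∃ f : MvPolynomial (Fin n) K, f.support ⊆ S ∧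
      ∀ y, eval (fun v => if B.block v = b then y v else x v) B.poly = eval y f := by
  obtain ⟨hl, hm, hr⟩ := hQ
  induction b using Fin.cases with
  | zero =>
    refine ⟨_, hl, ∑ k, ((List.ofFn fun i => (B.mid i).map (eval x)).prod.mulVec
      fun k => eval x (B.right k)) k • B.left k, support_sum_smul_subset_monomials _ _,
      fun y => ?_⟩
    rw [eval_poly, map_sum]
    have h1 : (fun i => (B.mid i).map (eval fun v => if B.block v = 0 then y v else x v)) =
        fun i => (B.mid i).map (eval x) := funext fun i => B.map_eval_mid_congr i fun v hv => by
      rw [hv, if_neg (Fin.succ_ne_zero _)]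
    have h2 : (fun k => eval (fun v => if B.block v = 0 then y v else x v) (B.right k)) =
        fun k => eval x (B.right k) := funext fun k =>
      eval_eq_of_mem_supported (B.right_mem k) fun v hv => by
        rw [Set.mem_ofPred_eq] at hv
        rw [hv, if_neg (Fin.last_pos).ne']
    rw [h1, h2]
    refine sum_congr rfl fun k _ => ?_
    rw [smul_eval, mul_comm, ← B.eval_left_mix x y k (fun _ h => h)]
  | succ b =>
    induction b using Fin.lastCases with
    | last =>
      refine ⟨_, hr, ∑ k, (Matrix.vecMul (fun k => eval x (B.left k))
        (List.ofFn fun i => (B.mid i).map (eval x)).prod) k • B.right k,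
        support_sum_smul_subset_monomials _ _, fun y => ?_⟩
      rw [eval_poly, map_sum, Fin.succ_last]
      have h1 : (fun i => (B.mid i).map
          (eval fun v => if B.block v = Fin.last (B.d + 1) then y v else x v)) =
          fun i => (B.mid i).map (eval x) := funext fun i => B.map_eval_mid_congr i fun v hv => by
        rw [hv, if_neg]
        rw [← Fin.succ_last, Fin.succ_inj]
        exact Fin.castSucc_ne_last i
      have h2 : (fun k => eval (fun v => if B.block v = Fin.last (B.d + 1) then y v else x v)
          (B.left k)) = fun k => eval x (B.left k) := funext fun k =>
        eval_eq_of_mem_supported (B.left_mem k) fun v hv => by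
          rw [Set.mem_ofPred_eq] at hv
          rw [hv, if_neg (Fin.last_pos).ne]
      rw [h1, h2, Matrix.dotProduct_mulVec]
      refine sum_congr rfl fun k _ => ?_
      rw [smul_eval, ← B.eval_right_mix x y k (fun _ h => h)]
    | cast i =>
      let L := List.ofFn fun j => (B.mid j).map (eval x)
      let u := Matrix.vecMul (fun k => eval x (B.left k)) (L.take i).prod
      let c := (L.drop (i + 1)).prod.mulVec fun k => eval x (B.right k)
      refine ⟨_, hm i, ∑ p : Fin w × Fin w, (u p.1 * c p.2) • B.mid i p.1 p.2,
        support_sum_smul_subset_monomials (fun p : Fin w × Fin w => B.mid i p.1 p.2) _,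
        fun y => ?_⟩
      rw [eval_poly, map_sum]
      have h1 : (fun j => (B.mid j).map
          (eval fun v => if B.block v = i.castSucc.succ then y v else x v)) =
          Function.update (fun j => (B.mid j).map (eval x)) i ((B.mid i).map (eval y)) := by
        funext j
        by_cases hj : j = i
        · subst hj
          rw [Function.update_self]
          exact B.map_eval_mid_congr j fun v hv => if_pos hv
        · rw [Function.update_of_ne hj]
          refine B.map_eval_mid_congr j fun v hv => ?_
          rw [hv, if_neg]
          rwa [Fin.succ_inj, Fin.castSucc_inj]
      have h2 : (fun k => eval (fun v => if B.block v = i.castSucc.succ then y v else x v)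
          (B.left k)) = fun k => eval x (B.left k) := funext fun k =>
        eval_eq_of_mem_supported (B.left_mem k) fun v hv => by
          rw [Set.mem_ofPred_eq] at hv
          rw [hv, if_neg (Fin.succ_ne_zero _).symm]
      have h3 : (fun k => eval (fun v => if B.block v = i.castSucc.succ then y v else x v)
          (B.right k)) = fun k => eval x (B.right k) := funext fun k =>
        eval_eq_of_mem_supported (B.right_mem k) fun v hv => by
          rw [Set.mem_ofPred_eq] at hv
          rw [hv, if_neg]
          rw [← Fin.succ_last, Fin.succ_inj]
          exact (Fin.castSucc_ne_last i).symm
      rw [h1, h2, h3, list_ofFn_update, List.prod_set, if_pos (by simp), Matrix.dotProduct_mulVec,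
        ← Matrix.vecMul_vecMul, ← Matrix.vecMul_vecMul, ← Matrix.dotProduct_mulVec,
        ← Matrix.dotProduct_mulVec, Fintype.sum_prod_type]
      refine sum_congr rfl fun k _ => ?_
      rw [Matrix.mulVec, dotProduct, mul_sum]
      refine sum_congr rfl fun l _ => ?_
      rw [smul_eval, Matrix.map_apply]
      ring

/-- A nonzero value is still found after moving all but few blocks of variables to a point where
the middle factors are invertible. -/
theorem exists_block_set {α y : Fin n → K} (hα : ∀ i, eval α (B.mid i).det ≠ 0)
    (hy : eval y B.poly ≠ 0) : ∃ J : Finset (Fin (B.d + 2)), J.card ≤ w + 1 ∧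
      eval (fun v => if B.block v ∈ J then y v else α v) B.poly ≠ 0 := by
  classical
  let val := mixedValue (fun k => eval y (B.left k)) (fun k => eval y (B.right k))
    (fun i => (B.mid i).map (eval y)) fun i => (B.mid i).map (eval α)
  have hne : (univ.filter fun J => val J ≠ 0).Nonempty := by
    refine ⟨univ, mem_filter.2 ⟨mem_univ _, ?_⟩⟩
    simpa [val, mixedValue, eval_poly] using hy
  obtain ⟨J, hJ, hmin⟩ := exists_min_image _ card hne
  have hJw : J.card < w := by
    refine card_lt_of_minimal _ _ _ _ (fun i => ?_) J (mem_filter.1 hJ).2 fun J' hJ' => ?_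
    · have := hα i
      rw [RingHom.map_det] at this
      exact this
    · by_contra h
      exact absurd (hmin J' (mem_filter.2 ⟨mem_univ _, h⟩)) (not_le.2 (card_lt_card hJ'))
  -- The outer factors are vectors, to which invertibility does not apply, so their blocks also keep
  -- the values of `y`. Together with fewer than `w` middle blocks these are at most `w + 1`.
  let ι : Fin B.d ↪ Fin (B.d + 2) := Fin.castSuccEmb.trans (Fin.succEmb _)
  refine ⟨insert 0 (insert (Fin.last _) (J.map ι)), ?_, ?_⟩
  · refine (card_insert_le _ _).trans (Nat.succ_le_succ ((card_insert_le _ _).trans ?_))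
    rw [card_map]
    exact hJw
  · have hval : val J ≠ 0 := (mem_filter.1 hJ).2
    rw [eval_poly]
    simp only [val, mixedValue] at hval
    convert hval using 3 with k
    · exact B.eval_left_mix _ _ _ fun v hv => by simp [hv]
    · congr 1
      congr 1
      funext i
      have hi : i.castSucc.succ ∈ insert 0 (insert (Fin.last (B.d + 1)) (J.map ι)) ↔ i ∈ J := by
        have e : i.castSucc.succ = ι i := rfl
        rw [mem_insert, mem_insert, e, mem_map']
        refine ⟨fun h => ?_, fun h => Or.inr (Or.inr h)⟩
        rcases h with h | h | h
        · exact absurd h (Fin.succ_ne_zero _)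
        · rw [← e, ← Fin.succ_last, Fin.succ_inj] at h
          exact absurd h (Fin.castSucc_ne_last i)
        · exact h
      split_ifs with h
      · exact B.map_eval_mid_congr i fun v hv => by rw [hv, if_pos (hi.2 h)]
      · exact B.map_eval_mid_congr i fun v hv => by rw [hv, if_neg (fun h' => h (hi.1 h'))]
    · funext k
      exact B.eval_right_mix _ _ _ fun v hv => by simp [hv]

/-- The blocks are treated one after the other. With the other variables frozen, `exists_eval_block`
reduces to a single polynomial with monomials in one factor, and only the coordinates of its new
non-root inside the block are used. -/
theorem exists_eval_ne_zero_of_blocks [DecidableEq K] {Q : Finset (Fin n →₀ ℕ) → Prop} (hQ : B.EachFactor Q)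
    {α : Fin n → K} {r : ℕ}
    (hα : ∀ S, Q S → ∀ f : MvPolynomial (Fin n) K, f ≠ 0 → f.support ⊆ S →
      ∃ x : Fin n → K, eval x f ≠ 0 ∧ #{v | x v ≠ α v} ≤ r)
    (J : Finset (Fin (B.d + 2))) (x : Fin n → K) (hx : eval x B.poly ≠ 0) :
    ∃ x' : Fin n → K, eval x' B.poly ≠ 0 ∧ (∀ v, B.block v ∉ J → x' v = x v) ∧
      Set.ncard {v | B.block v ∈ J ∧ x' v ≠ α v} ≤ J.card * r := by
  induction J using Finset.induction_on with
  | empty => exact ⟨x, hx, fun _ _ => rfl, by simp⟩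
  | insert b J hb ih =>
    obtain ⟨x₁, h₁, hag, hc⟩ := ih
    obtain ⟨S, hS, f, hfS, hf⟩ := B.exists_eval_block hQ b x₁
    have hf0 : f ≠ 0 := by
      rintro rfl
      have := hf x₁
      simp only [ite_self, map_zero] at this
      exact h₁ this
    obtain ⟨x₂, h₂, hc₂⟩ := hα S hS f hf0 hfS
    refine ⟨fun v => if B.block v = b then x₂ v else x₁ v, by rwa [hf], fun v hv => ?_, ?_⟩
    · rw [mem_insert, not_or] at hv
      dsimp only
      rw [if_neg hv.1, hag v hv.2]
    · calc _ ≤ Set.ncard ({v | B.block v ∈ J ∧ x₁ v ≠ α v} ∪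
              (({v | x₂ v ≠ α v} : Finset (Fin n)) : Set (Fin n))) := by
            refine Set.ncard_le_ncard (fun v hv => ?_)
            by_cases h : B.block v = b
            · right
              simpa [h] using hv
            · left
              simpa [h] using hv
        _ ≤ _ := Set.ncard_union_le _ _
        _ ≤ J.card * r + r := by
            rw [Set.ncard_coe_finset]
            exact add_le_add hc hc₂
        _ = _ := by rw [card_insert_of_notMem hb, add_mul, one_mul]

variable {B}

theorem EachFactor.and {Q R : Finset (Fin n →₀ ℕ) → Prop} (hQ : B.EachFactor Q)
    (hR : B.EachFactor R) : B.EachFactor fun S => Q S ∧ R S :=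
  ⟨⟨hQ.1, hR.1⟩, fun i => ⟨hQ.2.1 i, hR.2.1 i⟩, hQ.2.2, hR.2.2⟩

theorem EachFactor.imp {Q R : Finset (Fin n →₀ ℕ) → Prop} (hQ : B.EachFactor Q)
    (h : ∀ S, Q S → R S) : B.EachFactor R :=
  ⟨h _ hQ.1, fun i => h _ (hQ.2.1 i), h _ hQ.2.2⟩

theorem totalDegree_le_card_block {b : Fin (B.d + 2)} {D : ℕ} {f : MvPolynomial (Fin n) K}
    (hf : f ∈ supported K {v | B.block v = b}) (hD : ∀ m ∈ f.support, ∀ v, m v ≤ D) :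
    f.totalDegree ≤ #{v | B.block v = b} * D :=
  totalDegree_le_card_mul (fun m hm v hv => by
    simpa using support_subset_of_mem_supported hf hm hv) hD

variable (B) in
theorem sum_card_block : #{v | B.block v = 0} + ∑ i : Fin B.d, #{v | B.block v = i.castSucc.succ}
    + #{v | B.block v = Fin.last _} = n := by
  have h := card_eq_sum_card_fiberwise (s := (univ : Finset (Fin n))) (t := univ) (f := B.block)
    (fun _ _ => mem_univ _)
  rw [card_univ, Fintype.card_fin, Fin.sum_univ_succ, Fin.sum_univ_castSucc] at h
  exact ((add_assoc _ _ _).trans h.symm)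

/-- The number of factors is unbounded, but the blocks are disjoint: each factor contributes at most
`D` per variable of its own block. -/
theorem totalDegree_poly_le {D : ℕ} (hD : B.DegreeLE D) : B.poly.totalDegree ≤ n * D := by
  obtain ⟨hl, hm, hr⟩ := hD
  calc B.poly.totalDegree ≤ #{v | B.block v = 0} * D +
        (∑ i : Fin B.d, #{v | B.block v = i.castSucc.succ} * D + #{v | B.block v = Fin.last _} * D)
        := by
        refine totalDegree_finsetSum_le fun k _ => (totalDegree_mul _ _).trans (add_le_add ?_ ?_)
        · exact totalDegree_le_card_block (B.left_mem k) fun m hm =>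
            hl m (support_subset_monomials _ _ hm)
        · refine totalDegree_finsetSum_le fun l _ => (totalDegree_mul _ _).trans (add_le_add ?_ ?_)
          · refine totalDegree_prod_ofFn_le _ _ (fun i k l => ?_) k l
            exact totalDegree_le_card_block (B.mid_mem i k l) fun m h =>
              hm i m (support_subset_monomials
                (fun p : Fin w × Fin w => B.mid i p.1 p.2) (k, l) h)
          · exact totalDegree_le_card_block (B.right_mem l) fun m hm =>
              hr m (support_subset_monomials _ _ hm)
    _ = (#{v | B.block v = 0} + ∑ i : Fin B.d, #{v | B.block v = i.castSucc.succ}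
          + #{v | B.block v = Fin.last _}) * D := by
        rw [← sum_mul]; ring
    _ = n * D := by rw [B.sum_card_block]

theorem support_mid_subset (i : Fin B.d) (k l : Fin w) :
    (B.mid i k l).support ⊆ monomials fun p : Fin w × Fin w => B.mid i p.1 p.2 :=
  support_subset_monomials (fun p : Fin w × Fin w => B.mid i p.1 p.2) (k, l)

theorem degree_det_mid_le {D : ℕ} (hD : B.DegreeLE D) (i : Fin B.d) :
    ∀ m ∈ (B.mid i).det.support, ∀ v, m v ≤ w * D := by
  intro m hm v
  obtain ⟨g, hg, rfl⟩ := exists_sum_of_mem_support_det _ (support_mid_subset i) hm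
  rw [Finsupp.finsetSum_apply]
  refine (sum_le_sum fun k _ => hD.2.1 i _ (hg k) v).trans ?_
  simp

theorem det_mid_mem (i : Fin B.d) :
    (B.mid i).det ∈ supported K {v | B.block v = i.castSucc.succ} := by
  rw [Matrix.det_apply]
  refine Subalgebra.sum_mem _ fun τ _ => ?_
  have h : ∏ k, B.mid i (τ k) k ∈ supported K {v | B.block v = i.castSucc.succ} :=
    Subalgebra.prod_mem _ fun k _ => B.mid_mem i _ _
  rcases Int.units_eq_one_or (Equiv.Perm.sign τ) with hs | hs <;> rw [hs]
  · simpa using h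
  · simpa using h

theorem sum_totalDegree_det_mid_le {D : ℕ} (hD : B.DegreeLE D) :
    ∑ i, (B.mid i).det.totalDegree ≤ n * (w * D) := by
  calc ∑ i, (B.mid i).det.totalDegree
      ≤ ∑ i : Fin B.d, #{v | B.block v = i.castSucc.succ} * (w * D) :=
        sum_le_sum fun i _ => totalDegree_le_card_block (det_mid_mem i) (degree_det_mid_le hD i)
    _ ≤ n * (w * D) := by
        rw [← sum_mul]
        refine Nat.mul_le_mul_right _ ?_
        have := B.sum_card_block
        omega

/-- Few steps along the curve lead to a point at which all middle factors are invertible and no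
coordinate vanishes. -/
theorem exists_mem_reachSet_det_ne_zero {a : ℕ → K} {q D r : ℕ} (ha : Set.InjOn a (Set.Iio q))
    (hn : 1 ≤ n) (hq : n * (n * (w * D) + n) < q) (hD : B.DegreeLE D)
    (hr : B.EachFactor (LowSupport r)) :
    ∃ α ∈ reachSet a n q (w * r), (∀ i, eval α (B.mid i).det ≠ 0) ∧ ∀ v, α v ≠ 0 := by
  classical
  obtain ⟨hnq, hwq, hnw⟩ := lt_of_mul_mul_add_lt hn hq
  -- The coordinate functions join the determinants because `exists_eval_ne_zero_of_lowSupport`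
  -- needs a base point without zero coordinates. Their degrees account for the summand `n` in the
  -- bound on `q`.
  let f : Fin B.d ⊕ Fin n → MvPolynomial (Fin n) K := Sum.elim (fun i => (B.mid i).det) X
  have hG : w * D < ((range q).image a).card := by
    rw [card_image_of_injOn (by simpa [Set.InjOn] using ha), card_range]
    exact hwq
  have hfq : n * ∑ i, (f i).totalDegree < q := by
    refine lt_of_le_of_lt (Nat.mul_le_mul_left _ ?_) hq
    rw [Fintype.sum_sum_type]
    refine add_le_add (sum_totalDegree_det_mid_le hD) ?_
    simp [f]
  have hf : ∀ i ∈ (univ : Finset (Fin B.d ⊕ Fin n)), ∃ x : Fin n → K, eval x (f i) ≠ 0 ∧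
      Set.ncard {u | x u ≠ 1} ≤ w * r := by
    rintro (i | v) -
    · obtain ⟨x, hx, hc⟩ := exists_eval_ne_zero_of_lowSupport hG (α := fun _ => 1)
        (fun _ => one_ne_zero) (B.mid_det i) (degree_det_mid_le hD i)
        (lowSupport_support_det _ (support_mid_subset i) (hr.2.1 i))
      refine ⟨x, hx, ?_⟩
      rwa [← Set.ncard_coe_finset, coe_filter_univ] at hc
    · exact ⟨fun _ => 1, by simp [f], by simp⟩
  obtain ⟨α, hα, h⟩ := exists_mem_reachSet ha hnq hn univ f hfq (w * r) 0 (fun _ => 1) rfl hf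
  rw [zero_add] at hα
  exact ⟨α, hα, fun i => h (Sum.inl i) (mem_univ _), fun v => by
    simpa [f] using h (Sum.inr v) (mem_univ _)⟩

/-- Of the steps, `w * r` lead to the point `α`, and `(w + 1) * r` imitate `r` changes in each of at
most `w + 1` blocks. -/
theorem exists_mem_reachSet_eval_ne_zero {a : ℕ → K} {q D r k : ℕ}
    (ha : Set.InjOn a (Set.Iio q)) (hn : 1 ≤ n) (hw : 1 ≤ w) (hq : n * (n * (w * D) + n) < q)
    (hk : w * r + (w + 1) * r ≤ k) (hD : B.DegreeLE D) (hr : B.EachFactor (LowSupport r))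
    (hB : B.poly ≠ 0) : ∃ p ∈ reachSet a n q k, eval p B.poly ≠ 0 := by
  classical
  obtain ⟨α, hα, hdet, hα0⟩ := exists_mem_reachSet_det_ne_zero ha hn hq hD hr
  obtain ⟨hnq, hwq, hnw⟩ := lt_of_mul_mul_add_lt hn hq
  have hDw : D ≤ w * D := Nat.le_mul_of_pos_left _ hw
  have hnD : n * D ≤ n * (w * D) := Nat.mul_le_mul_left _ hDw
  have hcard : ((range q).image a).card = q := by
    rw [card_image_of_injOn (by simpa [Set.InjOn] using ha), card_range]
  have hdeg := totalDegree_poly_le hD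
  obtain ⟨y, hy⟩ := exists_eval_ne_zero_of_degree_lt_card (D := n * D) (G := (range q).image a)
    (by rw [hcard]; exact hnD.trans_lt ((Nat.le_mul_of_pos_left _ hn).trans_lt hnw)) hB fun m hm v =>
      ((monomial_le_degreeOf v hm).trans (degreeOf_le_totalDegree _ v)).trans hdeg
  obtain ⟨J, hJ, hyJ⟩ := B.exists_block_set hdet hy
  obtain ⟨x, hx, hag, hc⟩ := B.exists_eval_ne_zero_of_blocks (EachFactor.and hD hr) (r := r)
    (α := α) (fun S hS f hf hfS => exists_eval_ne_zero_of_lowSupport (D := D)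
      (G := (range q).image a) (by rw [hcard]; exact hDw.trans_lt hwq) hα0 hf (fun m hm => hS.1 m (hfS hm))
      (hS.2.mono hfS)) J _ hyJ
  -- Outside the blocks in `J` the point `x` coincides with `α`, so only the changes inside them
  -- count.
  obtain ⟨p, hp, hpB⟩ := exists_mem_reachSet ha hnq hn {()} (fun _ => B.poly)
    (by
      rw [sum_singleton]
      exact (Nat.mul_le_mul_left _ (hdeg.trans hnD)).trans_lt hnw) ((w + 1) * r) (w * r) α hα fun _ _ =>
      ⟨x, hx, by
        refine (Set.ncard_le_ncard fun v hv => ?_).trans (hc.trans (Nat.mul_le_mul_right _ hJ))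
        refine ⟨?_, hv⟩
        by_contra h
        exact hv (by rw [hag v h, if_neg h])⟩
  exact ⟨p, reachSet_mono a n q hk hp, hpB () (mem_singleton_self _)⟩

/-- Any point differs from `(1, …, 1)` in at most `n` coordinates. This handles `n = 1`
independently of the width. -/
theorem exists_mem_reachSet_eval_ne_zero_of_le {a : ℕ → K} {q D k : ℕ}
    (ha : Set.InjOn a (Set.Iio q)) (hn : 1 ≤ n) (hq : n * (n * D + 1) < q)
    (hk : n ≤ k) (hD : B.DegreeLE D) (hB : B.poly ≠ 0) :
    ∃ p ∈ reachSet a n q k, eval p B.poly ≠ 0 := by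
  classical
  have hdeg := totalDegree_poly_le hD
  obtain ⟨y, hy⟩ := exists_eval_ne_zero_of_degree_lt_card (D := n * D) (G := (range q).image a)
    (by rw [card_image_of_injOn (by simpa [Set.InjOn] using ha), card_range]; nlinarith) hB
    fun m hm v => ((monomial_le_degreeOf v hm).trans (degreeOf_le_totalDegree _ v)).trans hdeg
  obtain ⟨p, hp, hpB⟩ := exists_mem_reachSet ha (by nlinarith) hn {()} (fun _ => B.poly)
    (by simp only [sum_singleton]; nlinarith) k 0 _ rfl fun _ _ => ⟨y, hy, by
      refine (Set.ncard_le_ncard (Set.subset_univ _)).trans ?_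
      rwa [Set.ncard_univ, Nat.card_fin]⟩
  exact ⟨p, by rwa [zero_add] at hp, hpB () (mem_singleton_self _)⟩

end InvROABP

end BlockReduction

/-! ### Extension of scalars and the choice of parameters -/

section BaseChange

open Finset MvPolynomial

namespace InvROABP

variable {F K : Type*} [Field F] [Field K] {n w : ℕ}

/-- Extension of scalars. -/
noncomputable def map (φ : F →+* K) (B : InvROABP F n w) : InvROABP K n w where
  d := B.d
  block := B.block
  left k := MvPolynomial.map φ (B.left k)
  mid i := (B.mid i).map (MvPolynomial.map φ)
  right k := MvPolynomial.map φ (B.right k)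
  left_mem k := by
    rw [mem_supported, vars_map_of_injective _ φ.injective]
    exact mem_supported.1 (B.left_mem k)
  mid_mem i k l := by
    rw [mem_supported, Matrix.map_apply, vars_map_of_injective _ φ.injective]
    exact mem_supported.1 (B.mid_mem i k l)
  right_mem k := by
    rw [mem_supported, vars_map_of_injective _ φ.injective]
    exact mem_supported.1 (B.right_mem k)
  mid_det i h := by
    have h' : MvPolynomial.map φ (B.mid i).det = 0 := by rw [RingHom.map_det]; exact h
    exact B.mid_det i (map_injective φ φ.injective (by rw [h', map_zero]))

theorem poly_map (φ : F →+* K) (B : InvROABP F n w) :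
    (B.map φ).poly = MvPolynomial.map φ B.poly := by
  rw [poly, poly, RingHom.map_dotProduct]
  congr 1
  funext k
  rw [Function.comp_apply, RingHom.map_mulVec]
  have h := map_list_prod ((MvPolynomial.map φ).mapMatrix (m := Fin w)) (List.ofFn B.mid)
  rw [List.map_ofFn] at h
  exact congr_fun (congr_arg₂ Matrix.mulVec h.symm rfl) k

theorem monomials_map (φ : F →+* K) {ι : Type*} [Fintype ι] (A : ι → MvPolynomial (Fin n) F) :
    monomials (fun i => MvPolynomial.map φ (A i)) = monomials A := by
  simp only [monomials, support_map_of_injective _ φ.injective]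

theorem EachFactor.map {B : InvROABP F n w} {Q : Finset (Fin n →₀ ℕ) → Prop}
    (h : B.EachFactor Q) (φ : F →+* K) : (B.map φ).EachFactor Q := by
  refine ⟨?_, fun i => ?_, ?_⟩
  · exact (monomials_map φ B.left).symm ▸ h.1
  · exact (monomials_map φ fun p : Fin w × Fin w => B.mid i p.1 p.2).symm ▸ h.2.1 i
  · exact (monomials_map φ B.right).symm ▸ h.2.2

theorem eval_poly_map [Algebra F K] (B : InvROABP F n w) (p : Fin n → K) :
    eval p (B.map (algebraMap F K)).poly = aeval p B.poly := by
  rw [poly_map, eval_map]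
  rfl

theorem poly_map_ne_zero (φ : F →+* K) {B : InvROABP F n w} (hB : B.poly ≠ 0) :
    (B.map φ).poly ≠ 0 := by
  rw [poly_map]
  intro h
  exact hB (map_injective φ φ.injective (by rw [h, map_zero]))

/-- Whichever term attains the minimum decides the alternative of `LowSupport`. The factor `w * w`
is slack in accordance with `supportBound`. -/
theorem eachFactor_lowSupport {B : InvROABP F n w} {s μ : ℕ} (hw : 1 ≤ w)
    (hs : B.SparsityLE s) (hμ : B.SupportLE μ) :
    B.EachFactor (LowSupport (min (Nat.clog 2 (w * w * s)) μ)) := by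
  rcases le_total (Nat.clog 2 (w * w * s)) μ with h | h
  · rw [min_eq_left h]
    refine hs.imp fun S hS => Or.inl (hS.trans ?_)
    exact (Nat.le_mul_of_pos_left s (Nat.mul_pos hw hw)).trans
      (Nat.le_pow_clog (by norm_num) _)
  · rw [min_eq_right h]
    exact hμ.imp fun S hS => Or.inr hS

theorem eachFactor_lowSupport_one {B : InvROABP F n w} (hB : B.Univariate) :
    B.EachFactor (LowSupport 1) := by
  classical
  have key : ∀ {ι : Type} [Fintype ι] (A : ι → MvPolynomial (Fin n) F) (b : Fin (B.d + 2)),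
      (∀ i, A i ∈ supported F {v | B.block v = b}) → LowSupport 1 (monomials A) := by
    intro ι _ A b hA
    refine Or.inr fun m hm => card_le_one.2 fun u hu v hv => hB ?_
    rw [monomials, mem_biUnion] at hm
    obtain ⟨i, -, hi⟩ := hm
    have h1 : B.block u = b := support_subset_of_mem_supported (hA i) hi hu
    have h2 : B.block v = b := support_subset_of_mem_supported (hA i) hi hv
    rw [h1, h2]
  exact ⟨key _ _ B.left_mem, fun i => key _ _ fun p => B.mid_mem i p.1 p.2,
    key _ _ B.right_mem⟩

end InvROABP

/-- The width, which does not matter for polynomials in one variable. -/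
def effectiveWidth (n w : ℕ) : ℕ := if n = 1 then 1 else w

/-- The number of field elements used as parameters. -/
def gridSize (n w δ s : ℕ) : ℕ := 2 * (n * n * δ * effectiveWidth n w * s) + 1

/-- The number of steps along the curve. -/
def numSteps (n w s μ : ℕ) : ℕ :=
  3 * (effectiveWidth n w *
    (min (Nat.clog 2 (effectiveWidth n w * effectiveWidth n w * s)) μ + 1))

namespace InvROABP

variable {F K : Type*} [Field F] [Field K] [Algebra F K] {n w : ℕ}

theorem exists_mem_reachSet_aeval_ne_zero {B : InvROABP F n w} {a : ℕ → K} {δ s μ r : ℕ}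
    (hn : 1 ≤ n) (hw : 1 ≤ w) (hδ : 1 ≤ δ) (hs : 1 ≤ s)
    (ha : Set.InjOn a (Set.Iio (gridSize n w δ s))) (hD : B.DegreeLE δ)
    (hr : B.EachFactor (LowSupport r))
    (hrk : w * r + (w + 1) * r ≤ 3 * (w * (min (Nat.clog 2 (w * w * s)) μ + 1)))
    (hB : B.poly ≠ 0) :
    ∃ p ∈ reachSet a n (gridSize n w δ s) (numSteps n w s μ), aeval p B.poly ≠ 0 := by
  have hBK := poly_map_ne_zero (algebraMap F K) hB
  simp only [← eval_poly_map]
  -- If `n = δ = s = 1`, the permitted time is a constant, so `w` must not enter the parameters; for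
  -- one variable a single step is enough.
  by_cases h1 : n = 1
  · refine exists_mem_reachSet_eval_ne_zero_of_le (D := δ) ha hn ?_ ?_ (hD.map _) hBK
    · have : δ ≤ δ * s := Nat.le_mul_of_pos_right _ hs
      simp only [gridSize, effectiveWidth, h1, if_true, one_mul, mul_one]
      omega
    · rw [numSteps, effectiveWidth, if_pos h1]
      omega
  · refine exists_mem_reachSet_eval_ne_zero (D := δ) ha hn hw ?_ ?_ (hD.map _) (hr.map _) hBK
    · simp only [gridSize, effectiveWidth, if_neg h1]
      have h2 : n * n * 1 ≤ n * n * (w * δ) :=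
        Nat.mul_le_mul_left _ (Nat.mul_pos hw hδ)
      have h3 : n * n * δ * w ≤ n * n * δ * w * s := Nat.le_mul_of_pos_right _ hs
      have h4 : n * (n * (w * δ) + n) = n * n * (w * δ) + n * n * 1 := by ring
      have h5 : n * n * (w * δ) = n * n * δ * w := by ring
      omega
    · rw [numSteps, effectiveWidth, if_neg h1]
      exact hrk

end InvROABP

end BaseChange

/-! ### Hoare triples with time bounds -/

section RAM

namespace FieldRAM

variable {K : Type*} [Field K]

/-- Started in a state with the property `Pre`, the program halts after at most `t` steps in a
state with the property `Post`. -/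
def Triple (a : ℕ → K) (Pre : State K → Prop) (p : Prog) (t : ℕ) (Post : State K → Prop) : Prop :=
  ∀ σ, Pre σ → ∃ (τ : State K) (u : ℕ), u ≤ t ∧ Exec a p σ τ u ∧ Post τ

variable {a : ℕ → K} {P Q R : State K → Prop} {p q : Prog} {t u : ℕ}

theorem Triple.seq (h₁ : Triple a P p t Q) (h₂ : Triple a Q q u R) :
    Triple a P (.seq p q) (t + u) R := by
  intro σ hσ
  obtain ⟨τ, t', ht, he, hτ⟩ := h₁ σ hσ
  obtain ⟨ρ, u', hu, he', hρ⟩ := h₂ τ hτ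
  exact ⟨ρ, t' + u', add_le_add ht hu, .seq he he', hρ⟩

theorem Triple.conseq {P' Q' : State K → Prop} (h : Triple a P p t Q) (hP : ∀ σ, P' σ → P σ)
    (hQ : ∀ σ, Q σ → Q' σ) (htu : t ≤ u) : Triple a P' p u Q' := by
  intro σ hσ
  obtain ⟨τ, t', ht, he, hτ⟩ := h σ (hP σ hσ)
  exact ⟨τ, t', ht.trans htu, he, hQ τ hτ⟩

theorem Triple.ite {x : ℕ} (h₁ : Triple a (fun σ => P σ ∧ σ.reg x ≠ 0) p t Q)
    (h₂ : Triple a (fun σ => P σ ∧ σ.reg x = 0) q t Q) :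
    Triple a P (.ite x p q) (t + 1) Q := by
  intro σ hσ
  by_cases hx : σ.reg x = 0
  · obtain ⟨τ, t', ht, he, hτ⟩ := h₂ σ ⟨hσ, hx⟩
    exact ⟨τ, t' + 1, Nat.succ_le_succ ht, .ite_eq hx he, hτ⟩
  · obtain ⟨τ, t', ht, he, hτ⟩ := h₁ σ ⟨hσ, hx⟩
    exact ⟨τ, t' + 1, Nat.succ_le_succ ht, .ite_ne hx he, hτ⟩

/-- The invariant is indexed by the number of iterations still to come, so it also proves
termination and gives the time. -/
theorem Triple.loop {x : ℕ} (Inv : ℕ → State K → Prop) (h₀ : ∀ σ, Inv 0 σ → σ.reg x = 0)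
    (h₁ : ∀ k σ, Inv (k + 1) σ → σ.reg x ≠ 0)
    (h : ∀ k, Triple a (Inv (k + 1)) p t (Inv k)) (k : ℕ) :
    Triple a (Inv k) (.loop x p) (k * (t + 1) + 1) (Inv 0) := by
  induction k with
  | zero => exact fun σ hσ => ⟨σ, 1, by omega, .loop_eq (h₀ σ hσ), hσ⟩
  | succ k ih =>
    intro σ hσ
    obtain ⟨τ, t', ht, he, hτ⟩ := h k σ hσ
    obtain ⟨ρ, u', hu, he', hρ⟩ := ih τ hτ
    exact ⟨ρ, t' + u' + 1, by rw [Nat.succ_mul]; omega, .loop_ne (h₁ k σ hσ) he he', hρ⟩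

/-- A nonempty sequence of basic instructions. -/
def straight : Instr → List Instr → Prog
  | i, [] => .instr i
  | i, j :: l => .seq (.instr i) (straight j l)

theorem exec_straight (a : ℕ → K) (i : Instr) (l : List Instr) (σ : State K) :
    Exec a (straight i l) σ ((i :: l).foldl (fun σ i => i.step a σ) σ) (l.length + 1) := by
  induction l generalizing i σ with
  | nil => exact .instr i σ
  | cons j l ih =>
    rw [List.length_cons, add_comm]
    exact .seq (.instr i σ) (ih j _)

theorem Triple.straight {i : Instr} {l : List Instr}
    (h : ∀ σ, P σ → Q ((i :: l).foldl (fun σ i => i.step a σ) σ)) (hl : l.length + 1 ≤ t) :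
    Triple a P (straight i l) t Q :=
  fun σ hσ => ⟨_, _, hl, exec_straight a i l σ, h σ hσ⟩

end FieldRAM

end RAM

/-! ### The enumeration program and the computation of one shift -/

section Enumeration

open Finset

namespace FieldRAM

variable {K : Type*} [Field K] {a : ℕ → K}

open Instr

/-- Field register 2 becomes the coordinate of `curve` with the number in register 14, for the
parameter in field register 1. Registers 16 to 18 and field register 3 are used. -/
def curveProg : Prog :=
  .seq (straight (fone 2) [add 16 0 7]) <| .loop 16 <|
    .seq (straight (sub 16 16 5) [sub 17 14 16, sub 18 16 14, add 17 17 18]) <|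
      .ite 17 (straight (felem 3 16) [fsub 3 1 3, fmul 2 2 3]) (straight (const 17 0) [])

/-- The next `n` field registers from the address in register 11 on are added to a multiple of
`curve` and appended to the stored list, whose end is in register 19. -/
def shiftProg : Prog :=
  .seq (straight (const 14 0) [add 15 0 7]) <|
  .seq (.loop 15 <| .seq curveProg <| straight (fmul 2 2 0)
    [fload 3 11, fadd 2 2 3, fstore 19 2, add 19 19 5, add 11 11 5, add 14 14 5, sub 15 0 14]) <|
  straight (sub 11 11 0) []

/-- Register 6 holds `q`; register 13 counts the index of the multiplier down, and field register 0
holds the multiplier. -/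
def multiplesProg : Prog :=
  .seq (straight (add 13 6 7) []) <|
  .loop 13 <| .seq (straight (sub 13 13 5) [felem 0 13]) shiftProg

def allShiftsProg : Prog :=
  .seq (straight (add 12 6 7) []) <|
  .loop 12 <| .seq (straight (sub 12 12 5) [felem 1 12]) multiplesProg

/-- Register 9 freezes the end of the list, so that points appended during the stage are not
processed in it. Register 11 addresses the current point. -/
def stageProg : Prog :=
  .seq (straight (const 11 10) [add 9 19 7, sub 10 9 11]) <|
  .loop 10 <| .seq allShiftsProg <| straight (add 11 11 0) [sub 10 9 11]

def stagesProg : Prog := .loop 8 <| .seq stageProg <| straight (sub 8 8 5) []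

def initProg : Prog :=
  .seq (straight (const 19 10) [add 10 0 7, fone 2]) <|
  .loop 10 <| straight (fstore 19 2) [add 19 19 5, sub 10 10 5]

def emitProg : Prog :=
  .seq (straight (const 11 10) [sub 10 19 11]) <|
  .loop 10 <| straight (fload 2 11) [emit 2, add 11 11 5, sub 10 19 11]

/-- The constants in the registers 0, 5, 6 and 7. -/
structure Consts (n q : ℕ) (σ : State K) : Prop where
  dim : σ.reg 0 = n
  one : σ.reg 5 = 1
  grid : σ.reg 6 = q
  zero : σ.reg 7 = 0
  out : σ.out = []

/-- The list `M` is stored in the field registers from 10 on. -/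
structure Stored (n q : ℕ) (M : List K) (σ : State K) : Prop extends Consts n q σ where
  tail : σ.reg 19 = 10 + M.length
  mem : ∀ k (h : k < M.length), σ.fld (10 + k) = M[k]

omit [Field K] in
theorem Stored.congr {n q : ℕ} {M : List K} {σ τ : State K} (h : Stored n q M σ)
    (hreg : ∀ r < 8, τ.reg r = σ.reg r) (htail : τ.reg 19 = σ.reg 19)
    (hfld : ∀ f ≥ 10, τ.fld f = σ.fld f) (hout : τ.out = σ.out) : Stored n q M τ where
  dim := by rw [hreg 0 (by omega), h.dim]
  one := by rw [hreg 5 (by omega), h.one]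
  grid := by rw [hreg 6 (by omega), h.grid]
  zero := by rw [hreg 7 (by omega), h.zero]
  out := by rw [hout, h.out]
  tail := by rw [htail, h.tail]
  mem k hk := by rw [hfld _ (by omega), h.mem k hk]

omit [Field K] in
theorem Stored.append {n q : ℕ} {M : List K} {c : K} {σ τ : State K} (h : Stored n q M σ)
    (hreg : ∀ r < 8, τ.reg r = σ.reg r) (htail : τ.reg 19 = σ.reg 19 + 1)
    (hfld : ∀ f ≥ 10, f ≠ 10 + M.length → τ.fld f = σ.fld f) (hc : τ.fld (10 + M.length) = c)
    (hout : τ.out = σ.out) : Stored n q (M ++ [c]) τ where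
  dim := by rw [hreg 0 (by omega), h.dim]
  one := by rw [hreg 5 (by omega), h.one]
  grid := by rw [hreg 6 (by omega), h.grid]
  zero := by rw [hreg 7 (by omega), h.zero]
  out := by rw [hout, h.out]
  tail := by rw [htail, h.tail, List.length_append, List.length_singleton, add_assoc]
  mem k hk := by
    rw [List.length_append, List.length_singleton] at hk
    by_cases hkM : k < M.length
    · rw [hfld _ (by omega) (by omega), h.mem k hkM, List.getElem_append_left hkM]
    · obtain rfl : k = M.length := by omega
      rw [hc, List.getElem_append_right le_rfl]
      simp

/-- The state `σ₀` relates the final registers to the initial ones. The counter in register 16 runs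
downwards, so the partial products extend over `Ico k n` without `i`. -/
theorem curveProg_spec {n q : ℕ} (M : List K) (i : ℕ) (σ₀ : State K) :
    Triple a (fun σ => Stored n q M σ ∧ σ = σ₀ ∧ σ.reg 14 = i) curveProg (9 * n + 3)
      (fun σ => Stored n q M σ ∧ σ.fld 2 = ∏ j ∈ (range n).erase i, (σ₀.fld 1 - a j) ∧
        (∀ r < 16, σ.reg r = σ₀.reg r) ∧ σ.fld 0 = σ₀.fld 0 ∧ σ.fld 1 = σ₀.fld 1) := by
  let Inv : ℕ → State K → Prop := fun k σ => k ≤ n ∧ σ.reg 16 = k ∧ σ₀.reg 14 = i ∧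
    Stored n q M σ ∧ σ.fld 2 = ∏ j ∈ (Ico k n).erase i, (σ₀.fld 1 - a j) ∧
        (∀ r < 16, σ.reg r = σ₀.reg r) ∧ σ.fld 0 = σ₀.fld 0 ∧ σ.fld 1 = σ₀.fld 1
  have h1 : Triple a (fun σ => Stored n q M σ ∧ σ = σ₀ ∧ σ.reg 14 = i)
      (straight (fone 2) [add 16 0 7]) 2 (Inv n) := by
    refine Triple.straight ?_ (by simp)
    rintro σ ⟨hM, rfl, hi⟩
    refine ⟨le_rfl, ?_, hi, hM.congr ?_ ?_ ?_ ?_, ?_, ?_, ?_, ?_⟩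
    all_goals simp [Instr.step, Function.update_apply, hM.dim, hM.zero]
    all_goals intros; omega
  have h2 : ∀ k, Triple a (Inv (k + 1))
      (.seq (straight (sub 16 16 5) [sub 17 14 16, sub 18 16 14, add 17 17 18]) <|
      .ite 17 (straight (felem 3 16) [fsub 3 1 3, fmul 2 2 3]) (straight (const 17 0) [])) (4 + (3 + 1))
      (Inv k) := by
    intro k
    refine Triple.seq (Q := fun σ => k < n ∧ σ.reg 16 = k ∧ σ₀.reg 14 = i ∧
      Stored n q M σ ∧ σ.fld 2 = ∏ j ∈ (Ico (k + 1) n).erase i, (σ₀.fld 1 - a j) ∧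
        (∀ r < 16, σ.reg r = σ₀.reg r) ∧ σ.fld 0 = σ₀.fld 0 ∧ σ.fld 1 = σ₀.fld 1 ∧
        σ.reg 17 = (i - k) + (k - i)) (Triple.straight ?_ (by simp)) (Triple.ite
          (Triple.straight ?_ (by simp)) (Triple.straight ?_ (by simp)))
    · rintro σ ⟨hk, h16, hi, hM, hp, hr, hz, hy⟩
      have h14 := hr 14 (by omega)
      refine ⟨hk, ?_, hi, hM.congr ?_ ?_ ?_ ?_, ?_, ?_, ?_, ?_, ?_⟩
      all_goals simp [Instr.step, Function.update_apply, hM.one, h16, hp, hz, hy, h14, hi]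
      all_goals intro r hr'
      all_goals simp (disch := omega) [hr, Nat.ne_of_lt]
    · rintro σ ⟨⟨hk, h16, hi, hM, hp, hr, hz, hy, h17⟩, hne⟩
      refine ⟨hk.le, ?_, hi, hM.congr ?_ ?_ ?_ ?_, ?_, ?_, ?_, ?_⟩
      · simpa [Instr.step] using h16
      · simp [Instr.step]
      · simp [Instr.step]
      · intro f hf
        simp (disch := omega) [Instr.step, Function.update_of_ne]
      · simp [Instr.step]
      · have e : (Ico k n).erase i = insert k ((Ico (k + 1) n).erase i) := by
          rw [← insert_Ico_add_one_left_eq_Ico hk, erase_insert_of_ne (by omega)]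
        rw [e, prod_insert (by simp)]
        simp [Instr.step, hp, hy, h16, mul_comm]
      · simpa [Instr.step] using hr
      · simpa [Instr.step] using hz
      · simpa [Instr.step] using hy
    -- The sum of the two truncated differences vanishes only for `k = i`, the factor to be skipped.
    -- Writing 0 to register 17 then changes nothing.
    · rintro σ ⟨⟨hk, h16, hi, hM, hp, hr, hz, hy, h17⟩, h0⟩
      refine ⟨hk.le, ?_, hi, hM.congr ?_ ?_ ?_ ?_, ?_, ?_, ?_, ?_⟩
      · simpa [Instr.step] using h16
      · intro r hr'
        simp (disch := omega) [Instr.step, Function.update_of_ne]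
      · simp [Instr.step]
      · simp [Instr.step]
      · simp [Instr.step]
      · obtain rfl : k = i := by omega
        have e : (Ico k n).erase k = (Ico (k + 1) n).erase k := by
          rw [← insert_Ico_add_one_left_eq_Ico hk, erase_insert_eq_erase]
        rw [e]
        simpa [Instr.step] using hp
      · intro r hr'
        simp (disch := omega) [Instr.step, Function.update_of_ne, hr]
      · simpa [Instr.step] using hz
      · simpa [Instr.step] using hy
  refine ((h1.seq (Triple.loop Inv (fun σ h => h.2.1) (fun k σ h => by rw [h.2.1]; omega) h2 n)).conseq
    (fun _ h => h) ?_ (by omega))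
  rintro σ ⟨-, -, -, hM, hp, h⟩
  rw [← range_eq_Ico] at hp
  exact ⟨hM, hp, h⟩

/-- The point stored from position `b` of the list `M` on. -/
def PointAt {n : ℕ} (M : List K) (b : ℕ) (p : Fin n → K) : Prop :=
  ∀ i : Fin n, M[b + i]? = some (p i)

omit [Field K] in
theorem PointAt.append {n : ℕ} {M : List K} {b : ℕ} {p : Fin n → K} (h : PointAt M b p)
    (L : List K) : PointAt (M ++ L) b p := by
  intro i
  rw [List.getElem?_append_left, h i]
  exact (List.getElem?_eq_some_iff.1 (h i)).1

/-- The translate of `p` by a multiple of a point of the curve. -/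
def shift (a : ℕ → K) {n : ℕ} (p : Fin n → K) (y z : K) : Fin n → K :=
  fun i => p i + z * curve a n y i

theorem shiftProg_spec {n q : ℕ} (M : List K) (b : ℕ) (p : Fin n → K) (hp : PointAt M b p)
    (σ₀ : State K) (hb : σ₀.reg 11 = 10 + b) :
    Triple a (fun σ => Stored n q M σ ∧ σ = σ₀) shiftProg (n * (9 * n + 12) + 4)
      (fun σ => Stored n q (M ++ List.ofFn (shift a p (σ₀.fld 1) (σ₀.fld 0))) σ ∧
        (∀ r < 14, σ.reg r = σ₀.reg r) ∧ σ.fld 1 = σ₀.fld 1) := by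
  set L := List.ofFn (shift a p (σ₀.fld 1) (σ₀.fld 0)) with hL
  have hLn : L.length = n := by simp [hL]
  let Inv : ℕ → State K → Prop := fun k σ => k ≤ n ∧ σ.reg 15 = k ∧ σ.reg 14 = n - k ∧
    Stored n q (M ++ L.take (n - k)) σ ∧ σ.reg 11 = 10 + b + (n - k) ∧
    (∀ r < 14, r ≠ 11 → σ.reg r = σ₀.reg r) ∧ σ.fld 0 = σ₀.fld 0 ∧ σ.fld 1 = σ₀.fld 1
  have h1 : Triple a (fun σ => Stored n q M σ ∧ σ = σ₀)
      (straight (const 14 0) [add 15 0 7]) 2 (Inv n) := by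
    refine Triple.straight ?_ (by simp)
    rintro σ ⟨hM, rfl⟩
    refine ⟨le_rfl, ?_, ?_, ?_, ?_, ?_, ?_, ?_⟩
    · simp [Instr.step, hM.dim, hM.zero]
    · simp [Instr.step]
    · rw [Nat.sub_self, List.take_zero, List.append_nil]
      refine hM.congr ?_ ?_ ?_ ?_
      · intro r hr
        simp (disch := omega) [Instr.step, Function.update_of_ne]
      all_goals simp [Instr.step]
    · simpa [Instr.step] using hb
    · intro r hr _
      simp (disch := omega) [Instr.step, Function.update_of_ne]
    · simp [Instr.step]
    · simp [Instr.step]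
  have h2 : ∀ k, Triple a (Inv (k + 1)) (.seq curveProg <| straight (fmul 2 2 0)
      [fload 3 11, fadd 2 2 3, fstore 19 2, add 19 19 5, add 11 11 5, add 14 14 5, sub 15 0 14])
      (9 * n + 3 + 8) (Inv k) := by
    intro k σ₁ ⟨hk, h15, h14, hM, h11, hr, hz, hy⟩
    refine Triple.seq (curveProg_spec (n := n) (q := q) (M ++ L.take (n - (k + 1))) (n - (k + 1))
      σ₁) (Triple.straight ?_ (by simp)) σ₁ ⟨hM, rfl, h14⟩
    rintro σ ⟨hM', h2, hr', hz', hy'⟩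
    have hr1 := hr' 11 (by omega)
    have hr2 := hr' 14 (by omega)
    have hlen : (L.take (n - (k + 1))).length = n - (k + 1) := by
      rw [List.length_take, hLn]; omega
    have htl := hM'.tail
    have hlt : n - (k + 1) < n := by omega
    -- The point being read lies in the original list `M`, so the coordinates appended so far do not
    -- disturb it.
    have hload : σ.fld (10 + b + (n - (k + 1))) = p ⟨n - (k + 1), hlt⟩ := by
      have h := (hp.append (L.take (n - (k + 1)))) ⟨n - (k + 1), hlt⟩
      obtain ⟨h3, h4⟩ := List.getElem?_eq_some_iff.1 h
      rw [add_assoc, hM'.mem _ h3, h4]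
    have htake : L.take (n - k) = L.take (n - (k + 1)) ++
        [shift a p (σ₀.fld 1) (σ₀.fld 0) ⟨n - (k + 1), hlt⟩] := by
      rw [show n - k = n - (k + 1) + 1 by omega, List.take_succ_eq_append_getElem (by omega)]
      simp [hL]
    have e1 : n - (k + 1) + 1 = n - k := by omega
    refine ⟨by omega, ?_, ?_, ?_, ?_, ?_, ?_, ?_⟩
    · simp [Instr.step, hM'.dim, hM'.one, hr2, h14]; omega
    · simp [Instr.step, hM'.one, hr2, h14]; omega
    · rw [htake, ← List.append_assoc]
      refine hM'.append ?_ ?_ ?_ ?_ ?_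
      · intro r hr
        simp (disch := omega) [Instr.step, Function.update_of_ne]
      · simp [Instr.step, hM'.one]
      · intro f hf hne
        have : f ≠ σ.reg 19 := by rw [htl]; exact hne
        simp (disch := omega) [Instr.step, Function.update_of_ne]
      · simp only [Instr.step, List.foldl_cons, List.foldl_nil]
        simp (disch := omega) only [Function.update_of_ne, Function.update_self, htl, hr1, h11,
          hload, h2, hz', hz, hy, hlen, List.length_append, ← add_assoc]
        rw [shift, curve]; ring
      · simp [Instr.step]
    · simp [Instr.step, hM'.one, hr1, h11]; omega
    · intro r hr1 hr2
      simp (disch := omega) [Instr.step, Function.update_of_ne]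
      rw [hr' r (by omega), hr r hr1 hr2]
    -- The write address is at least 10, so the scratch field registers survive.
    · have : 0 ≠ σ.reg 19 := by omega
      simp (disch := omega) [Instr.step, Function.update_of_ne, hz', hz]
    · have : 1 ≠ σ.reg 19 := by omega
      simp (disch := omega) [Instr.step, Function.update_of_ne, hy', hy]
  refine (h1.seq ((Triple.loop Inv (fun σ h => h.2.1) (fun k σ h => by rw [h.2.1]; omega) h2
    n).seq (Triple.straight (t := 1) (Q := fun σ => Stored n q (M ++ L) σ ∧
        (∀ r < 14, σ.reg r = σ₀.reg r) ∧ σ.fld 1 = σ₀.fld 1) ?_ (by simp)))).conseq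
    (fun _ h => h) (fun _ h => h) (by ring_nf; omega)
  rintro σ ⟨-, h15, h14, hM, h11, hr, hz, hy⟩
  rw [Nat.sub_zero, List.take_of_length_le hLn.le] at hM
  refine ⟨hM.congr ?_ ?_ ?_ ?_, ?_, ?_⟩
  · intro r hr
    simp (disch := omega) [Instr.step, Function.update_of_ne]
  · simp [Instr.step]
  · simp [Instr.step]
  · simp [Instr.step]
  · intro r hr'
    by_cases h : r = 11
    · subst h
      simp [Instr.step, h11, hM.dim, hb]
    · simp (disch := omega) [Instr.step, Function.update_of_ne, hr]
  · simpa [Instr.step] using hy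

end FieldRAM

end Enumeration

/-! ### Loops over parameters, points and stages -/

section EnumerationLoops

open Finset

namespace FieldRAM

variable {K : Type*} [Field K] {a : ℕ → K}

open Instr

/-- The list of all coordinates of a list of points. -/
def coords {n : ℕ} (pts : List (Fin n → K)) : List K := (pts.map List.ofFn).flatten

omit [Field K] in
theorem coords_append {n : ℕ} (pts qts : List (Fin n → K)) :
    coords (pts ++ qts) = coords pts ++ coords qts := by
  simp [coords]

omit [Field K] in
theorem coords_singleton {n : ℕ} (p : Fin n → K) : coords [p] = List.ofFn p := by
  simp [coords]

omit [Field K] in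
theorem length_coords {n : ℕ} (pts : List (Fin n → K)) : (coords pts).length = pts.length * n := by
  induction pts with
  | nil => simp [coords]
  | cons p pts ih =>
    rw [← List.singleton_append, coords_append, List.length_append, ih, coords_singleton,
      List.length_ofFn, List.length_append, List.length_singleton, add_mul, one_mul]

omit [Field K] in
theorem pointAt_coords {n : ℕ} (pts : List (Fin n → K)) (L : List K) {k : ℕ}
    (hk : k < pts.length) : PointAt (coords pts ++ L) (k * n) pts[k] := by
  refine PointAt.append ?_ L
  have h : pts = pts.take k ++ ([pts[k]] ++ pts.drop (k + 1)) := by simp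
  intro i
  have hlen : (coords (pts.take k)).length = k * n := by
    rw [length_coords, List.length_take, min_eq_left hk.le]
  conv_lhs => rw [h]
  rw [coords_append, List.getElem?_append_right (by omega), hlen, Nat.add_sub_cancel_left,
    coords_append, coords_singleton, List.getElem?_append_left (by simp)]
  simp

theorem multiplesProg_spec {n q : ℕ} (M : List K) (b : ℕ) (p : Fin n → K) (hp : PointAt M b p)
    (σ₀ : State K) (hb : σ₀.reg 11 = 10 + b) :
    Triple a (fun σ => Stored n q M σ ∧ σ = σ₀) multiplesProg
      (q * (n * (9 * n + 12) + 7) + 2)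
      (fun σ => (∃ L : List (Fin n → K), Stored n q (M ++ coords L) σ ∧ L.length = q ∧
        ∀ z < q, shift a p (σ₀.fld 1) (a z) ∈ L) ∧
        (∀ r < 13, σ.reg r = σ₀.reg r) ∧ σ.fld 1 = σ₀.fld 1) := by
  let Inv : ℕ → State K → Prop := fun k σ => σ.reg 13 = k ∧ k ≤ q ∧
    (∃ L : List (Fin n → K), Stored n q (M ++ coords L) σ ∧ L.length = q - k ∧
        ∀ z < q, k ≤ z → shift a p (σ₀.fld 1) (a z) ∈ L) ∧
        (∀ r < 13, σ.reg r = σ₀.reg r) ∧ σ.fld 1 = σ₀.fld 1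
  have h1 : Triple a (fun σ => Stored n q M σ ∧ σ = σ₀) (straight (add 13 6 7) []) 1 (Inv q) := by
    refine Triple.straight ?_ (by simp)
    rintro σ ⟨hM, rfl⟩
    refine ⟨?_, le_rfl, ⟨[], ?_, by simp, fun z h h' => absurd h (not_lt.2 h')⟩, ?_, ?_⟩
    · simp [Instr.step, hM.grid, hM.zero]
    · rw [coords, List.map_nil, List.flatten_nil, List.append_nil]
      refine hM.congr ?_ ?_ ?_ ?_
      · intro r hr
        simp (disch := omega) [Instr.step, Function.update_of_ne]
      all_goals simp [Instr.step]
    · intro r hr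
      simp (disch := omega) [Instr.step, Function.update_of_ne]
    · simp [Instr.step]
  have h2 : ∀ k, Triple a (Inv (k + 1)) (.seq (straight (sub 13 13 5) [felem 0 13]) shiftProg)
      (2 + (n * (9 * n + 12) + 4)) (Inv k) := by
    intro k σ₁ ⟨h13, hk, ⟨L, hM, hL, hmem⟩, hr, hy⟩
    let σ₂ := (felem 0 13).step a ((sub 13 13 5).step a σ₁)
    have hreg : ∀ r < 13, σ₂.reg r = σ₀.reg r := by
      intro r hr'
      simp (disch := omega) [σ₂, Instr.step, Function.update_of_ne, hr]
    have h13' : σ₂.reg 13 = k := by simp [σ₂, Instr.step, h13, hM.one]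
    have hz' : σ₂.fld 0 = a k := by simp [σ₂, Instr.step, h13, hM.one]
    have hy' : σ₂.fld 1 = σ₀.fld 1 := by simp [σ₂, Instr.step, hy]
    have hM' : Stored n q (M ++ coords L) σ₂ := by
      refine hM.congr ?_ ?_ ?_ ?_
      · intro r hr
        simp (disch := omega) [σ₂, Instr.step, Function.update_of_ne]
      · simp [σ₂, Instr.step]
      · intro f hf
        simp (disch := omega) [σ₂, Instr.step, Function.update_of_ne]
      · simp [σ₂, Instr.step]
    refine Triple.seq (Q := fun σ => Stored n q (M ++ coords L) σ ∧ σ = σ₂) (P := fun σ => σ = σ₁)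
      (Triple.straight ?_ (by simp)) ((shiftProg_spec (M ++ coords L) b p (hp.append _) σ₂
        (by rw [hreg 11 (by omega), hb])).conseq (fun _ h => h) ?_ le_rfl) σ₁ rfl
    · rintro σ rfl
      exact ⟨hM', rfl⟩
    · rintro σ ⟨hS, hr', hy''⟩
      rw [List.append_assoc, ← coords_singleton, ← coords_append, hy', hz'] at hS
      refine ⟨by rw [hr' 13 (by omega), h13'], by omega, ⟨_, hS, ?_, ?_⟩, ?_, ?_⟩
      · rw [List.length_append, List.length_singleton]; omega
      · intro z hz hkz
        rw [List.mem_append, List.mem_singleton]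
        rcases hkz.eq_or_lt with rfl | h
        · exact Or.inr rfl
        · exact Or.inl (hmem z hz h)
      · intro r h
        rw [hr' r (by omega), hreg r h]
      · rw [hy'', hy']
  refine ((h1.seq (Triple.loop Inv (fun σ h => h.1) (fun k σ h => by rw [h.1]; omega) h2
    q)).conseq (fun _ h => h) ?_ (le_of_eq (by ring)))
  rintro σ ⟨-, -, ⟨L, hM, hL, hmem⟩, hr⟩
  exact ⟨⟨L, hM, hL, fun z hz => hmem z hz (Nat.zero_le _)⟩, hr⟩

theorem allShiftsProg_spec {n q : ℕ} (M : List K) (b : ℕ) (p : Fin n → K) (hp : PointAt M b p)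
    (σ₀ : State K) (hb : σ₀.reg 11 = 10 + b) :
    Triple a (fun σ => Stored n q M σ ∧ σ = σ₀) allShiftsProg
      (q * (q * (n * (9 * n + 12) + 7) + 5) + 2)
      (fun σ => (∃ L : List (Fin n → K), Stored n q (M ++ coords L) σ ∧ L.length = q * q ∧
        ∀ y < q, ∀ z < q, shift a p (a y) (a z) ∈ L) ∧ (∀ r < 12, σ.reg r = σ₀.reg r)) := by
  let Inv : ℕ → State K → Prop := fun k σ => σ.reg 12 = k ∧ k ≤ q ∧
    (∃ L : List (Fin n → K), Stored n q (M ++ coords L) σ ∧ L.length = (q - k) * q ∧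
        ∀ y < q, k ≤ y → ∀ z < q, shift a p (a y) (a z) ∈ L) ∧ (∀ r < 12, σ.reg r = σ₀.reg r)
  have h1 : Triple a (fun σ => Stored n q M σ ∧ σ = σ₀) (straight (add 12 6 7) []) 1 (Inv q) := by
    refine Triple.straight ?_ (by simp)
    rintro σ ⟨hM, rfl⟩
    refine ⟨?_, le_rfl, ⟨[], ?_, by simp, fun y h h' => absurd h (not_lt.2 h')⟩, ?_⟩
    · simp [Instr.step, hM.grid, hM.zero]
    · rw [coords, List.map_nil, List.flatten_nil, List.append_nil]
      refine hM.congr ?_ ?_ ?_ ?_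
      · intro r hr
        simp (disch := omega) [Instr.step, Function.update_of_ne]
      all_goals simp [Instr.step]
    · intro r hr
      simp (disch := omega) [Instr.step, Function.update_of_ne]
  have h2 : ∀ k, Triple a (Inv (k + 1))
      (.seq (straight (sub 12 12 5) [felem 1 12]) multiplesProg)
      (2 + (q * (n * (9 * n + 12) + 7) + 2)) (Inv k) := by
    intro k σ₁ ⟨h12, hk, ⟨L, hM, hL, hmem⟩, hr⟩
    let σ₂ := (felem 1 12).step a ((sub 12 12 5).step a σ₁)
    have hreg : ∀ r < 12, σ₂.reg r = σ₀.reg r := by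
      intro r hr'
      simp (disch := omega) [σ₂, Instr.step, Function.update_of_ne, hr]
    have h12' : σ₂.reg 12 = k := by simp [σ₂, Instr.step, h12, hM.one]
    have hy' : σ₂.fld 1 = a k := by simp [σ₂, Instr.step, h12, hM.one]
    have hM' : Stored n q (M ++ coords L) σ₂ := by
      refine hM.congr ?_ ?_ ?_ ?_
      · intro r hr
        simp (disch := omega) [σ₂, Instr.step, Function.update_of_ne]
      · simp [σ₂, Instr.step]
      · intro f hf
        simp (disch := omega) [σ₂, Instr.step, Function.update_of_ne]
      · simp [σ₂, Instr.step]
    refine Triple.seq (Q := fun σ => Stored n q (M ++ coords L) σ ∧ σ = σ₂) (P := fun σ => σ = σ₁)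
      (Triple.straight ?_ (by simp)) ((multiplesProg_spec (M ++ coords L) b p (hp.append _) σ₂
        (by rw [hreg 11 (by omega), hb])).conseq (fun _ h => h) ?_ le_rfl) σ₁ rfl
    · rintro σ rfl
      exact ⟨hM', rfl⟩
    · rintro σ ⟨⟨L', hS, hL', hmem'⟩, hr', -⟩
      rw [List.append_assoc, ← coords_append] at hS
      rw [hy'] at hmem'
      refine ⟨by rw [hr' 12 (by omega), h12'], by omega, ⟨_, hS, ?_, ?_⟩, ?_⟩
      · rw [List.length_append, hL, hL', show q - k = q - (k + 1) + 1 by omega, add_mul, one_mul]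
      · intro y hy hky z hz
        rw [List.mem_append]
        rcases hky.eq_or_lt with rfl | h
        · exact Or.inr (hmem' z hz)
        · exact Or.inl (hmem y hy h z hz)
      · intro r h
        rw [hr' r (by omega), hreg r h]
  refine ((h1.seq (Triple.loop Inv (fun σ h => h.1) (fun k σ h => by rw [h.1]; omega) h2
    q)).conseq (fun _ h => h) ?_ (le_of_eq (by ring)))
  rintro σ ⟨-, -, ⟨L, hM, hL, hmem⟩, hr⟩
  exact ⟨⟨L, hM, hL, fun y hy => hmem y hy (Nat.zero_le _)⟩, hr⟩

theorem stageProg_spec {n q : ℕ} (hn : 1 ≤ n) (pts : List (Fin n → K)) (σ₀ : State K) :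
    Triple a (fun σ => Stored n q (coords pts) σ ∧ σ = σ₀) stageProg
      (pts.length * (q * (q * (n * (9 * n + 12) + 7) + 5) + 5) + 4)
      (fun σ => (∃ L : List (Fin n → K), Stored n q (coords (pts ++ L)) σ ∧
        L.length = pts.length * (q * q) ∧
        ∀ p ∈ pts, ∀ y < q, ∀ z < q, shift a p (a y) (a z) ∈ L) ∧ σ.reg 8 = σ₀.reg 8) := by
  set N := pts.length with hN
  let Inv : ℕ → State K → Prop := fun k σ => k ≤ N ∧ σ.reg 10 = k * n ∧ σ.reg 9 = 10 + N * n ∧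
    σ.reg 11 = 10 + (N - k) * n ∧
    (∃ L : List (Fin n → K), Stored n q (coords pts ++ coords L) σ ∧ L.length = (N - k) * (q * q) ∧
        ∀ i (hi : i < N), i < N - k → ∀ y < q, ∀ z < q, shift a pts[i] (a y) (a z) ∈ L) ∧
        σ.reg 8 = σ₀.reg 8
  have h1 : Triple a (fun σ => Stored n q (coords pts) σ ∧ σ = σ₀)
      (straight (const 11 10) [add 9 19 7, sub 10 9 11]) 3 (Inv N) := by
    refine Triple.straight ?_ (by simp)
    rintro σ ⟨hM, rfl⟩
    have ht := hM.tail
    rw [length_coords] at ht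
    refine ⟨le_rfl, ?_, ?_, ?_, ⟨[], ?_, by simp, fun i _ h' => by omega⟩, ?_⟩
    · simp [Instr.step, ht, hM.zero, hN]
    · simp [Instr.step, ht, hM.zero, hN]
    · simp [Instr.step]
    · rw [coords, coords, List.map_nil, List.flatten_nil, List.append_nil]
      refine hM.congr ?_ ?_ ?_ ?_
      · intro r hr
        simp (disch := omega) [Instr.step, Function.update_of_ne]
      all_goals simp [Instr.step]
    · simp [Instr.step]
  have h2 : ∀ k, Triple a (Inv (k + 1))
      (.seq allShiftsProg <| straight (add 11 11 0) [sub 10 9 11])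
      (q * (q * (n * (9 * n + 12) + 7) + 5) + 2 + 2) (Inv k) := by
    intro k σ₁ ⟨hk, h10, h9, h11, ⟨L, hM, hL, hmem⟩, h8⟩
    have hlt : N - (k + 1) < pts.length := by omega
    refine Triple.seq (allShiftsProg_spec (coords pts ++ coords L) ((N - (k + 1)) * n)
      pts[N - (k + 1)] (pointAt_coords pts _ hlt) σ₁ h11) (Triple.straight ?_ (by simp)) σ₁
      ⟨hM, rfl⟩
    rintro σ ⟨⟨L', hS, hL', hmem'⟩, hr⟩
    rw [List.append_assoc, ← coords_append] at hS
    have e1 : N - k = N - (k + 1) + 1 := by omega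
    have e3 : N * n = (N - (k + 1)) * n + n + k * n := by
      obtain ⟨c, hc⟩ := Nat.exists_eq_add_of_le hk
      have : N - (k + 1) = c := by omega
      rw [this, hc]; ring
    refine ⟨by omega, ?_, ?_, ?_, ⟨_, hS.congr ?_ ?_ ?_ ?_, ?_, ?_⟩, ?_⟩
    · simp [Instr.step, hr, h11, h9, hM.dim]; omega
    · simp [Instr.step, hr, h9]
    · simp [Instr.step, hr, h11, hM.dim]
      rw [e1, add_mul]; omega
    · intro r hr
      simp (disch := omega) [Instr.step, Function.update_of_ne]
    · simp [Instr.step]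
    · simp [Instr.step]
    · simp [Instr.step]
    · rw [List.length_append, hL, hL', e1, add_mul, one_mul]
    · intro i hi hik y hy z hz
      rw [List.mem_append]
      by_cases h : i < N - (k + 1)
      · exact Or.inl (hmem i hi h y hy z hz)
      · obtain rfl : i = N - (k + 1) := by omega
        exact Or.inr (hmem' y hy z hz)
    · simp [Instr.step, hr, h8]
  -- The loop tests the remaining number `k * n` of coordinates, which detects remaining points
  -- because `1 ≤ n`.
  refine ((h1.seq (Triple.loop Inv (fun σ h => by rw [h.2.1, zero_mul]) (fun k σ h => by
    rw [h.2.1]; exact (Nat.mul_pos k.succ_pos hn).ne') h2 N)).conseq (fun _ h => h) ?_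
    (le_of_eq (by ring)))
  rintro σ ⟨-, -, -, -, ⟨L, hM, hL, hmem⟩, h8⟩
  rw [← coords_append] at hM
  refine ⟨⟨L, hM, by rw [hL, Nat.sub_zero], fun p hp y hy z hz => ?_⟩, h8⟩
  obtain ⟨i, hi, rfl⟩ := List.mem_iff_getElem.1 hp
  exact hmem i hi (by omega) y hy z hz

/-- A bound for the time of one stage that starts with `N` points. -/
def stageTime (n q N : ℕ) : ℕ := N * (q * (q * (n * (9 * n + 12) + 7) + 5) + 5) + 4

theorem stagesProg_spec {n q m : ℕ} (hn : 1 ≤ n) :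
    Triple a (fun σ => Stored n q (coords [fun _ : Fin n => (1 : K)]) σ ∧ σ.reg 8 = m) stagesProg
      (m * (stageTime n q ((1 + q * q) ^ m) + 2) + 1)
      (fun σ => ∃ pts : List (Fin n → K), Stored n q (coords pts) σ ∧
        pts.length = (1 + q * q) ^ m ∧ ∀ p ∈ reachSet a n q m, p ∈ pts) := by
  let Inv : ℕ → State K → Prop := fun k σ => k ≤ m ∧ σ.reg 8 = k ∧
    ∃ pts : List (Fin n → K), Stored n q (coords pts) σ ∧
        pts.length = (1 + q * q) ^ (m - k) ∧ ∀ p ∈ reachSet a n q (m - k), p ∈ pts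
  have h2 : ∀ k, Triple a (Inv (k + 1)) (.seq stageProg <| straight (sub 8 8 5) [])
      (stageTime n q ((1 + q * q) ^ m) + 1) (Inv k) := by
    intro k σ₁ ⟨hk, h8, pts, hM, hl, hp⟩
    refine Triple.seq ((stageProg_spec hn pts σ₁).conseq (fun _ h => h) (fun _ h => h) ?_)
      (Triple.straight ?_ (by simp)) σ₁ ⟨hM, rfl⟩
    -- Every stage is charged as if it started with the final number of points.
    · rw [hl]
      exact Nat.add_le_add_right (Nat.mul_le_mul_right _
        (Nat.pow_le_pow_right (by omega) (Nat.sub_le _ _))) _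
    · rintro σ ⟨⟨L, hS, hL, hmem⟩, h8'⟩
      refine ⟨by omega, ?_, pts ++ L, hS.congr ?_ ?_ ?_ ?_, ?_, ?_⟩
      · simp [Instr.step, h8', h8, hS.one]
      · intro r hr
        simp (disch := omega) [Instr.step, Function.update_of_ne]
      · simp [Instr.step]
      · simp [Instr.step]
      · simp [Instr.step]
      · rw [List.length_append, hL, hl, show m - k = m - (k + 1) + 1 by omega, pow_succ]
        ring
      · rw [show m - k = m - (k + 1) + 1 by omega]
        rintro x (hx | ⟨p, hp', y, hy, z, hz, rfl⟩)
        · exact List.mem_append_left _ (hp x hx)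
        · exact List.mem_append_right _ (hmem p (hp p hp') y hy z hz)
  refine (Triple.loop Inv (fun σ h => h.2.1) (fun k σ h => by rw [h.2.1]; omega) h2 m).conseq
    ?_ ?_ le_rfl
  · rintro σ ⟨hM, h8⟩
    refine ⟨le_rfl, h8, _, hM, by simp, ?_⟩
    rw [Nat.sub_self]
    rintro p hp
    exact List.mem_singleton.2 hp
  · rintro σ ⟨-, -, pts, h⟩
    exact ⟨pts, h⟩

theorem initProg_spec {n q m : ℕ} :
    Triple a (fun σ => Consts n q σ ∧ σ.reg 8 = m) initProg (4 * n + 4)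
      (fun σ => Stored n q (coords [fun _ : Fin n => (1 : K)]) σ ∧ σ.reg 8 = m) := by
  let Inv : ℕ → State K → Prop := fun k σ => k ≤ n ∧ σ.reg 10 = k ∧ σ.fld 2 = 1 ∧
    Stored n q (List.replicate (n - k) 1) σ ∧ σ.reg 8 = m
  have h1 : Triple a (fun σ => Consts n q σ ∧ σ.reg 8 = m)
      (straight (const 19 10) [add 10 0 7, fone 2]) 3 (Inv n) := by
    refine Triple.straight ?_ (by simp)
    rintro σ ⟨hC, h8⟩
    refine ⟨le_rfl, ?_, ?_, ⟨⟨?_, ?_, ?_, ?_, ?_⟩, ?_, ?_⟩, ?_⟩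
    all_goals simp [Instr.step, hC.dim, hC.one, hC.grid, hC.zero, hC.out, h8]
  have h2 : ∀ k, Triple a (Inv (k + 1)) (straight (fstore 19 2) [add 19 19 5, sub 10 10 5])
      3 (Inv k) := by
    intro k
    refine Triple.straight ?_ (by simp)
    rintro σ ⟨hk, h10, hf, hM, h8⟩
    have ht := hM.tail
    refine ⟨by omega, ?_, ?_, ?_, ?_⟩
    · simp [Instr.step, h10, hM.one]
    · have : 2 ≠ σ.reg 19 := by omega
      simp [Instr.step, Function.update_of_ne this, hf]
    · rw [show n - k = n - (k + 1) + 1 by omega, List.replicate_succ']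
      refine hM.append ?_ ?_ ?_ ?_ ?_
      · intro r hr
        simp (disch := omega) [Instr.step, Function.update_of_ne]
      · simp [Instr.step, hM.one]
      · intro f hf' hne
        have : f ≠ σ.reg 19 := by omega
        simp [Instr.step, Function.update_of_ne this]
      · rw [← ht]
        simp [Instr.step, hf]
      · simp [Instr.step]
    · simp [Instr.step, h8]
  refine (h1.seq (Triple.loop Inv (fun σ h => h.2.1) (fun k σ h => by rw [h.2.1]; omega) h2
    n)).conseq (fun _ h => h) ?_ (le_of_eq (by ring))
  rintro σ ⟨-, -, -, hM, h8⟩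
  rw [coords_singleton, List.ofFn_const]
  exact ⟨hM, h8⟩

theorem emitProg_spec {n q : ℕ} (M : List K) :
    Triple a (Stored n q M) emitProg (M.length * 5 + 3) (fun σ => σ.out = M) := by
  let Inv : ℕ → State K → Prop := fun k σ => k ≤ M.length ∧ σ.reg 10 = k ∧
    σ.reg 11 = 10 + (M.length - k) ∧ σ.reg 19 = 10 + M.length ∧ σ.reg 5 = 1 ∧
    (∀ i (h : i < M.length), σ.fld (10 + i) = M[i]) ∧ σ.out = M.take (M.length - k)
  have h1 : Triple a (Stored n q M) (straight (const 11 10) [sub 10 19 11]) 2 (Inv M.length) := by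
    refine Triple.straight ?_ (by simp)
    intro σ hM
    refine ⟨le_rfl, ?_, ?_, ?_, ?_, ?_, ?_⟩
    · simp [Instr.step, hM.tail]
    · simp [Instr.step]
    · simp [Instr.step, hM.tail]
    · simp [Instr.step, hM.one]
    · simpa [Instr.step] using hM.mem
    · simp [Instr.step, hM.out]
  have h2 : ∀ k, Triple a (Inv (k + 1))
      (straight (fload 2 11) [emit 2, add 11 11 5, sub 10 19 11]) 4 (Inv k) := by
    intro k
    refine Triple.straight ?_ (by simp)
    rintro σ ⟨hk, h10, h11, h19, h5, hmem, hout⟩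
    refine ⟨by omega, ?_, ?_, ?_, ?_, ?_, ?_⟩
    · simp [Instr.step, h11, h19, h5]; omega
    · simp [Instr.step, h11, h5]; omega
    · simp [Instr.step, h19]
    · simp [Instr.step, h5]
    · intro i hi
      simp (disch := omega) [Instr.step, Function.update_of_ne, hmem i hi]
    · rw [show M.length - k = M.length - (k + 1) + 1 by omega,
        List.take_succ_eq_append_getElem (by omega)]
      simp [Instr.step, h11, hout, hmem _ (show M.length - (k + 1) < M.length by omega)]
  refine (h1.seq (Triple.loop Inv (fun σ h => h.2.1) (fun k σ h => by rw [h.2.1]; omega) h2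
    M.length)).conseq (fun _ h => h) ?_ (le_of_eq (by ring))
  rintro σ ⟨-, -, -, -, -, -, h⟩
  rw [h, Nat.sub_zero, List.take_length]

/-- Enumeration of all reachable points, given the number of stages in register 8. -/
def enumProg : Prog := .seq initProg <| .seq stagesProg emitProg

def enumTime (n q m : ℕ) : ℕ :=
  4 * n + 4 + (m * (stageTime n q ((1 + q * q) ^ m) + 2) + 1 + ((1 + q * q) ^ m * n * 5 + 3))

theorem enumProg_spec {n q m : ℕ} (hn : 1 ≤ n) :
    Triple a (fun σ => Consts n q σ ∧ σ.reg 8 = m) enumProg (enumTime n q m)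
      (fun σ => ∃ pts : List (Fin n → K), σ.out = coords pts ∧
        pts.length = (1 + q * q) ^ m ∧ ∀ p ∈ reachSet a n q m, p ∈ pts) := by
  refine initProg_spec.seq ((stagesProg_spec hn).seq ?_)
  rintro σ ⟨pts, hM, hl, hp⟩
  obtain ⟨τ, u, hu, he, hτ⟩ := emitProg_spec (coords pts) σ hM
  exact ⟨τ, u, by rwa [length_coords, hl] at hu, he, pts, hτ, hl, hp⟩

end FieldRAM

end EnumerationLoops

/-! ### Computing the parameters from the input -/

section Preparation

namespace FieldRAM

variable {K : Type*} [Field K] {a : ℕ → K}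

open Instr

/-- The input in the registers 0 to 4, before any output. -/
structure Inputs (n w δ s μ : ℕ) (σ : State K) : Prop where
  dim : σ.reg 0 = n
  width : σ.reg 1 = w
  degree : σ.reg 2 = δ
  sparsity : σ.reg 3 = s
  support : σ.reg 4 = μ
  out : σ.out = []

/-- The input together with the constants in the registers 5 and 7. -/
structure Prepared (n w δ s μ : ℕ) (σ : State K) : Prop extends Inputs n w δ s μ σ where
  one : σ.reg 5 = 1
  zero : σ.reg 7 = 0

omit [Field K] in
theorem Prepared.congr {n w δ s μ : ℕ} {σ τ : State K} (h : Prepared n w δ s μ σ)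
    (hreg : ∀ r < 8, r ≠ 6 → τ.reg r = σ.reg r) (hout : τ.out = σ.out) :
    Prepared n w δ s μ τ where
  dim := by rw [hreg 0 (by omega) (by omega), h.dim]
  width := by rw [hreg 1 (by omega) (by omega), h.width]
  degree := by rw [hreg 2 (by omega) (by omega), h.degree]
  sparsity := by rw [hreg 3 (by omega) (by omega), h.sparsity]
  support := by rw [hreg 4 (by omega) (by omega), h.support]
  one := by rw [hreg 5 (by omega) (by omega), h.one]
  zero := by rw [hreg 7 (by omega) (by omega), h.zero]
  out := by rw [hout, h.out]

/-- Multiplication by repeated addition. -/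
def mulProg (x y z : ℕ) : Prog :=
  .seq (straight (const x 0) [add 25 z 7]) <| .loop 25 <| straight (add x x y) [sub 25 25 5]

/-- The cost depends only on the multiplier in register `z`. Targets from 20 on keep the inputs and
constants intact. -/
theorem mulProg_spec {n w δ s μ : ℕ} {x y z : ℕ} (hx : 20 ≤ x) (hxy : y ≠ x) (hxz : z ≠ x)
    (hx25 : x ≠ 25) (hy : y ≠ 25) {σ₀ : State K} (h : Prepared n w δ s μ σ₀) :
    ∃ (τ : State K) (u : ℕ), u ≤ 3 * σ₀.reg z + 3 ∧ Exec a (mulProg x y z) σ₀ τ u ∧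
      Prepared n w δ s μ τ ∧ τ.reg x = σ₀.reg y * σ₀.reg z ∧
      ∀ r, r ≠ x → r ≠ 25 → τ.reg r = σ₀.reg r := by
  set c := σ₀.reg z with hc
  let Inv : ℕ → State K → Prop := fun k σ => k ≤ c ∧ Prepared n w δ s μ σ ∧ σ.reg 25 = k ∧
    σ.reg x = σ₀.reg y * (c - k) ∧ ∀ r, r ≠ x → r ≠ 25 → σ.reg r = σ₀.reg r
  have h1 : Triple a (fun σ => σ = σ₀) (straight (const x 0) [add 25 z 7]) 2 (Inv c) := by
    refine Triple.straight ?_ (by simp)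
    rintro σ rfl
    refine ⟨le_rfl, h.congr ?_ ?_, ?_, ?_, ?_⟩
    · intro r hr _
      simp (disch := omega) [Instr.step, Function.update_of_ne]
    · simp [Instr.step]
    · simp (disch := omega) [Instr.step, Function.update_of_ne, h.zero, hc]
    · simp (disch := omega) [Instr.step, Function.update_of_ne]
    · intro r hr hr'
      simp (disch := omega) [Instr.step, Function.update_of_ne]
  have h2 : ∀ k, Triple a (Inv (k + 1)) (straight (add x x y) [sub 25 25 5]) 2 (Inv k) := by
    intro k
    refine Triple.straight ?_ (by simp)
    rintro σ ⟨hk, hP, h25, hxc, hr⟩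
    refine ⟨by omega, hP.congr ?_ ?_, ?_, ?_, ?_⟩
    · intro r hr _
      simp (disch := omega) [Instr.step, Function.update_of_ne]
    · simp [Instr.step]
    · simp (disch := omega) [Instr.step, Function.update_of_ne, hP.one, h25]
    · simp (disch := omega) [Instr.step, Function.update_of_ne, hxc, hr y hxy hy]
      rw [show c - k = c - (k + 1) + 1 by omega, mul_add, mul_one]
    · intro r hr1 hr2
      simp (disch := omega) [Instr.step, Function.update_of_ne, hr r hr1 hr2]
  obtain ⟨τ, u, hu, he, -, hP, -, hxc, hr⟩ := (h1.seq (Triple.loop Inv (fun σ h => h.2.2.1)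
    (fun k σ h => by rw [h.2.2.1]; omega) h2 c)) σ₀ rfl
  exact ⟨τ, u, by omega, he, hP, by rw [hxc, Nat.sub_zero], hr⟩

def clogProg : Prog :=
  .seq (straight (const 23 1) [const 24 0, sub 25 22 23]) <|
  .loop 25 <| straight (add 23 23 23) [add 24 24 5, sub 25 22 23]

theorem clogProg_spec {n w δ s μ : ℕ} {σ₀ : State K} (h : Prepared n w δ s μ σ₀) :
    ∃ (τ : State K) (u : ℕ), u ≤ 4 * Nat.clog 2 (σ₀.reg 22) + 4 ∧ Exec a clogProg σ₀ τ u ∧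
      Prepared n w δ s μ τ ∧ τ.reg 24 = Nat.clog 2 (σ₀.reg 22) ∧ τ.reg 6 = σ₀.reg 6 := by
  set c := Nat.clog 2 (σ₀.reg 22) with hc
  -- The truncated difference tested by the loop first vanishes after exactly `c` doublings.
  have hpow : ∀ k, σ₀.reg 22 - 2 ^ k = 0 ↔ c ≤ k := fun k => by
    rw [Nat.sub_eq_zero_iff_le, hc, Nat.clog_le_iff_le_pow (by norm_num)]
  let Inv : ℕ → State K → Prop := fun k σ => k ≤ c ∧ Prepared n w δ s μ σ ∧
    σ.reg 25 = σ₀.reg 22 - 2 ^ (c - k) ∧ σ.reg 23 = 2 ^ (c - k) ∧ σ.reg 24 = c - k ∧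
    σ.reg 22 = σ₀.reg 22 ∧ σ.reg 6 = σ₀.reg 6
  have h1 : Triple a (fun σ => σ = σ₀) (straight (const 23 1) [const 24 0, sub 25 22 23]) 3
      (Inv c) := by
    refine Triple.straight ?_ (by simp)
    rintro σ rfl
    refine ⟨le_rfl, h.congr ?_ ?_, ?_⟩
    · intro r hr _
      simp (disch := omega) [Instr.step, Function.update_of_ne]
    · simp [Instr.step]
    · simp [Instr.step]
  have h2 : ∀ k, Triple a (Inv (k + 1))
      (straight (add 23 23 23) [add 24 24 5, sub 25 22 23]) 3 (Inv k) := by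
    intro k
    refine Triple.straight ?_ (by simp)
    rintro σ ⟨hk, hP, h25, h23, h24, h22, h6⟩
    have e : c - k = c - (k + 1) + 1 := by omega
    refine ⟨by omega, hP.congr ?_ ?_, ?_⟩
    · intro r hr _
      simp (disch := omega) [Instr.step, Function.update_of_ne]
    · simp [Instr.step]
    · simp [Instr.step, h22, h23, h24, h6, hP.one, e, pow_succ, mul_two]
  obtain ⟨τ, u, hu, he, -, hP, -, -, h24, -, h6⟩ := (h1.seq (Triple.loop Inv
    (fun σ h => by rw [h.2.2.1, hpow]; exact le_rfl)
    (fun k σ h => by rw [h.2.2.1, Ne, hpow]; have := h.1; omega) h2 c)) σ₀ rfl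
  exact ⟨τ, u, by omega, he, hP, by rw [h24, Nat.sub_zero], h6⟩

/-- Replaces the width by 1 if the number of variables is 1. -/
def widthProg : Prog :=
  .seq (straight (const 5 1) [const 7 0, sub 20 0 5]) <|
  .ite 20 (straight (const 20 0) []) (straight (const 1 1) [])

theorem widthProg_spec {n w δ s μ : ℕ} (hn : 1 ≤ n) :
    Triple a (Inputs n w δ s μ) widthProg 5 (Prepared n (effectiveWidth n w) δ s μ) := by
  refine Triple.seq (t := 3) (u := 2) (Q := fun σ => Prepared n w δ s μ σ ∧ σ.reg 20 = n - 1)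
    (Triple.straight ?_ (by simp)) (Triple.ite (Triple.straight ?_ (by simp))
      (Triple.straight ?_ (by simp)))
  · intro σ h
    refine ⟨⟨⟨?_, ?_, ?_, ?_, ?_, ?_⟩, ?_, ?_⟩, ?_⟩
    all_goals simp [Instr.step, h.dim, h.width, h.degree, h.sparsity, h.support, h.out]
  · rintro σ ⟨⟨h, h20⟩, hne⟩
    have hn1 : n ≠ 1 := by omega
    refine ⟨⟨?_, ?_, ?_, ?_, ?_, ?_⟩, ?_, ?_⟩
    all_goals simp [Instr.step, h.dim, h.width, h.degree, h.sparsity, h.support, h.out, h.one,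
      h.zero, effectiveWidth, hn1]
  · rintro σ ⟨⟨h, h20⟩, hne⟩
    have hn1 : n = 1 := by omega
    refine ⟨⟨?_, ?_, ?_, ?_, ?_, ?_⟩, ?_, ?_⟩
    all_goals simp [Instr.step, h.dim, h.degree, h.sparsity, h.support, h.out, h.one,
      h.zero, effectiveWidth, hn1]

/-- The multiplier is always one of the parameters and never the growing product, which keeps the
time linear in the parameters. -/
def gridProg : Prog :=
  .seq (mulProg 21 0 0) <| .seq (mulProg 22 21 2) <| .seq (mulProg 21 22 1) <|
  .seq (mulProg 22 21 3) <| straight (add 6 22 22) [add 6 6 5]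

theorem gridProg_spec {n w δ s μ : ℕ} :
    Triple a (Prepared n w δ s μ) gridProg (3 * (n + δ + w + s) + 14)
      (fun σ => Prepared n w δ s μ σ ∧ σ.reg 6 = 2 * (n * n * δ * w * s) + 1) := by
  intro σ h
  obtain ⟨σ₁, u₁, hu₁, he₁, h₁, hx₁, hr₁⟩ := mulProg_spec (a := a) (x := 21) (y := 0) (z := 0)
    (by omega) (by omega) (by omega) (by omega) (by omega) h
  obtain ⟨σ₂, u₂, hu₂, he₂, h₂, hx₂, hr₂⟩ := mulProg_spec (a := a) (x := 22) (y := 21) (z := 2)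
    (by omega) (by omega) (by omega) (by omega) (by omega) h₁
  obtain ⟨σ₃, u₃, hu₃, he₃, h₃, hx₃, hr₃⟩ := mulProg_spec (a := a) (x := 21) (y := 22) (z := 1)
    (by omega) (by omega) (by omega) (by omega) (by omega) h₂
  obtain ⟨σ₄, u₄, hu₄, he₄, h₄, hx₄, hr₄⟩ := mulProg_spec (a := a) (x := 22) (y := 21) (z := 3)
    (by omega) (by omega) (by omega) (by omega) (by omega) h₃
  refine ⟨_, _, ?_, .seq he₁ (.seq he₂ (.seq he₃ (.seq he₄ (exec_straight _ _ _ _)))),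
    h₄.congr ?_ ?_, ?_⟩
  · rw [h.dim] at hu₁
    rw [h₁.degree] at hu₂
    rw [h₂.width] at hu₃
    rw [h₃.sparsity] at hu₄
    simp only [List.length_singleton]
    omega
  · intro r hr hr'
    simp (disch := omega) [Instr.step, Function.update_of_ne]
  · simp [Instr.step]
  · simp [Instr.step, h₄.one]
    rw [hx₄, hx₃, hx₂, hx₁, h.dim, h₁.degree, h₂.width, h₃.sparsity]
    ring

/-- The minimum of `c` and `μ` is obtained as `c - (c - μ)` with truncated subtraction. -/
def numStepsProg : Prog :=
  .seq (mulProg 21 1 1) <| .seq (mulProg 22 21 3) <| .seq clogProg <|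
  .seq (straight (sub 26 24 4) [sub 26 24 26, add 26 26 5]) <| .seq (mulProg 21 1 26) <|
  straight (add 8 21 21) [add 8 8 21]

theorem numStepsProg_spec {n w δ s μ q : ℕ} :
    Triple a (fun σ => Prepared n w δ s μ σ ∧ σ.reg 6 = q) numStepsProg
      (3 * (w + s) + 7 * Nat.clog 2 (w * w * s) + 21)
      (fun σ => Consts n q σ ∧ σ.reg 8 = 3 * (w * (min (Nat.clog 2 (w * w * s)) μ + 1))) := by
  rintro σ ⟨h, h6⟩
  obtain ⟨σ₁, u₁, hu₁, he₁, h₁, hx₁, hr₁⟩ := mulProg_spec (a := a) (x := 21) (y := 1) (z := 1)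
    (by omega) (by omega) (by omega) (by omega) (by omega) h
  obtain ⟨σ₂, u₂, hu₂, he₂, h₂, hx₂, hr₂⟩ := mulProg_spec (a := a) (x := 22) (y := 21) (z := 3)
    (by omega) (by omega) (by omega) (by omega) (by omega) h₁
  obtain ⟨σ₃, u₃, hu₃, he₃, h₃, h24, h6₃⟩ := clogProg_spec (a := a) h₂
  rw [hx₂, hx₁, h.width, h₁.sparsity] at hu₃ h24
  set c := Nat.clog 2 (w * w * s)
  obtain ⟨σ₄, u₄, hu₄, he₄, h₄, h26, h6₄⟩ :
      ∃ (τ : State K) (u : ℕ), u ≤ 3 ∧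
        Exec a (straight (sub 26 24 4) [sub 26 24 26, add 26 26 5]) σ₃ τ u ∧
        Prepared n w δ s μ τ ∧ τ.reg 26 = min c μ + 1 ∧ τ.reg 6 = σ₃.reg 6 := by
    refine ⟨_, _, le_rfl, exec_straight _ _ _ _, h₃.congr ?_ ?_, ?_, ?_⟩
    · intro r hr hr'
      simp (disch := omega) [Instr.step, Function.update_of_ne]
    · simp [Instr.step]
    · simp [Instr.step, h₃.one, h24, h₃.support]
      omega
    · simp [Instr.step]
  obtain ⟨σ₅, u₅, hu₅, he₅, h₅, hx₅, hr₅⟩ := mulProg_spec (a := a) (x := 21) (y := 1) (z := 26)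
    (by omega) (by omega) (by omega) (by omega) (by omega) h₄
  rw [h26, h₄.width] at hx₅
  have h6₅ : σ₅.reg 6 = q := by
    rw [hr₅ 6 (by omega) (by omega), h6₄, h6₃, hr₂ 6 (by omega) (by omega),
      hr₁ 6 (by omega) (by omega), h6]
  refine ⟨_, _, ?_, .seq he₁ (.seq he₂ (.seq he₃ (.seq he₄ (.seq he₅
    (exec_straight _ _ _ _))))), ⟨?_, ?_, ?_, ?_, ?_⟩, ?_⟩
  · rw [h.width] at hu₁
    rw [h₁.sparsity] at hu₂
    rw [h26] at hu₅
    simp only [List.length_singleton]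
    omega
  · simp [Instr.step, h₅.dim]
  · simp [Instr.step, h₅.one]
  · simp [Instr.step, h6₅]
  · simp [Instr.step, h₅.zero]
  · simp [Instr.step, h₅.out]
  · simp [Instr.step, hx₅]
    ring

/-- The program that outputs the hitting set. -/
def hittingProg : Prog := .seq widthProg <| .seq gridProg <| .seq numStepsProg enumProg

def hittingTime (n w δ s μ : ℕ) : ℕ :=
  5 + (3 * (n + δ + effectiveWidth n w + s) + 14 + (3 * (effectiveWidth n w + s) +
    7 * Nat.clog 2 (effectiveWidth n w * effectiveWidth n w * s) + 21 +
      enumTime n (gridSize n w δ s) (numSteps n w s μ)))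

theorem hittingProg_spec {n w δ s μ : ℕ} (hn : 1 ≤ n) :
    Triple a (Inputs n w δ s μ) hittingProg (hittingTime n w δ s μ)
      (fun σ => ∃ pts : List (Fin n → K), σ.out = coords pts ∧
        pts.length = (1 + gridSize n w δ s * gridSize n w δ s) ^ numSteps n w s μ ∧
        ∀ p ∈ reachSet a n (gridSize n w δ s) (numSteps n w s μ), p ∈ pts) :=
  (widthProg_spec hn).seq (gridProg_spec.seq (numStepsProg_spec.seq (enumProg_spec hn)))

end FieldRAM

end Preparation

/-! ### Estimates of the running time -/

section TimeBound

namespace FieldRAM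

/-- The number of points is at most `q ^ (3 * m)`, the number of stages at most `q ^ m`, and the
work per point at most `q ^ 8`; the remaining `q ^ 4` absorbs the constants. -/
theorem enumTime_le {n q m : ℕ} (hn : n ≤ q) (hq : 3 ≤ q) : enumTime n q m ≤ q ^ (4 * m + 12) := by
  have hq1 : 1 ≤ q := by omega
  have hN : (1 + q * q) ^ m ≤ q ^ (3 * m) := by
    rw [pow_mul]
    exact Nat.pow_le_pow_left (by nlinarith) _
  have hm : m ≤ q ^ m := (Nat.lt_pow_self (by omega)).le
  have h0 : n * (9 * n + 12) + 7 ≤ q ^ 5 := by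
    have h1 : n * (9 * n + 12) ≤ q * (9 * q + 12) := Nat.mul_le_mul hn (by omega)
    have h2 : 3 ^ 3 ≤ q ^ 3 := Nat.pow_le_pow_left hq 3
    have h3 : 3 ^ 3 * q ^ 2 ≤ q ^ 3 * q ^ 2 := Nat.mul_le_mul_right _ h2
    have h4 : q ^ 5 = q ^ 3 * q ^ 2 := by ring
    nlinarith
  have h1 : q * (q * (n * (9 * n + 12) + 7) + 5) + 5 ≤ q ^ 8 := by
    have h2 : q * (q * (n * (9 * n + 12) + 7) + 5) ≤ q * (q * q ^ 5 + 5) := by gcongr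
    have h3 : 3 ^ 6 ≤ q ^ 6 := Nat.pow_le_pow_left hq 6
    have h4 : 3 * q ^ 7 ≤ q * q ^ 7 := Nat.mul_le_mul_right _ hq
    have h5 : q ^ 7 = q * q ^ 6 := by ring
    have h6 : q ^ 8 = q * q ^ 7 := by ring
    have h7 : q * (q * q ^ 5 + 5) = q ^ 7 + 5 * q := by ring
    have h8 : q * 3 ^ 6 ≤ q * q ^ 6 := Nat.mul_le_mul_left _ h3
    omega
  have hA : 1 ≤ q ^ (3 * m) := Nat.one_le_pow _ _ hq1
  have hB : 1 ≤ q ^ m := Nat.one_le_pow _ _ hq1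
  have h8 : 3 ^ 8 ≤ q ^ 8 := Nat.pow_le_pow_left hq 8
  have hst : stageTime n q ((1 + q * q) ^ m) + 2 ≤ 2 * (q ^ (3 * m) * q ^ 8) := by
    have h2 : (1 + q * q) ^ m * (q * (q * (n * (9 * n + 12) + 7) + 5) + 5) ≤
      q ^ (3 * m) * q ^ 8 := Nat.mul_le_mul hN h1
    have h3 : 1 * 3 ^ 8 ≤ q ^ (3 * m) * q ^ 8 := Nat.mul_le_mul hA h8
    unfold stageTime
    omega
  have h4 : m * (stageTime n q ((1 + q * q) ^ m) + 2) ≤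
      q ^ m * (2 * (q ^ (3 * m) * q ^ 8)) := Nat.mul_le_mul hm hst
  have h5 : (1 + q * q) ^ m * n ≤ q ^ (3 * m) * q := Nat.mul_le_mul hN hn
  have h6 : q ^ (4 * m + 12) = q ^ 4 * (q ^ m * (q ^ (3 * m) * q ^ 8)) := by ring
  have h7 : 3 ^ 4 * (q ^ m * (q ^ (3 * m) * q ^ 8)) ≤
      q ^ 4 * (q ^ m * (q ^ (3 * m) * q ^ 8)) :=
    Nat.mul_le_mul_right _ (Nat.pow_le_pow_left hq 4)
  have hq8 : q ≤ q ^ 8 := Nat.le_self_pow (by norm_num) q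
  have h9 : 1 * (q ^ (3 * m) * q) ≤ q ^ m * (q ^ (3 * m) * q ^ 8) :=
    Nat.mul_le_mul hB (Nat.mul_le_mul_left _ hq8)
  have h10 : 1 * q ≤ q ^ (3 * m) * q := Nat.mul_le_mul_right _ hA
  rw [h6]
  unfold enumTime
  have h11 : q ^ m * (2 * (q ^ (3 * m) * q ^ 8)) = 2 * (q ^ m * (q ^ (3 * m) * q ^ 8)) := by ring
  omega

theorem gridSize_bounds {n w δ s : ℕ} (hn : 1 ≤ n) (hw : 1 ≤ w) (hδ : 1 ≤ δ) (hs : 1 ≤ s) :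
    n ≤ gridSize n w δ s ∧ δ ≤ gridSize n w δ s ∧
      effectiveWidth n w * s ≤ gridSize n w δ s ∧ 3 ≤ gridSize n w δ s ∧
      gridSize n w δ s ≤ 3 * (n * n * δ * effectiveWidth n w * s) ∧ 1 ≤ effectiveWidth n w := by
  have hw' : 1 ≤ effectiveWidth n w := by
    unfold effectiveWidth; split_ifs <;> omega
  unfold gridSize
  generalize effectiveWidth n w = v at hw' ⊢
  have h1 : n * 1 ≤ n * (n * δ * v * s) :=
    Nat.mul_le_mul_left _ (Nat.one_le_iff_ne_zero.2 (by positivity))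
  have h2 : δ * 1 ≤ δ * (n * n * v * s) :=
    Nat.mul_le_mul_left _ (Nat.one_le_iff_ne_zero.2 (by positivity))
  have h3 : v * s * 1 ≤ v * s * (n * n * δ) :=
    Nat.mul_le_mul_left _ (Nat.one_le_iff_ne_zero.2 (by positivity))
  have e1 : n * (n * δ * v * s) = n * n * δ * v * s := by ring
  have e2 : δ * (n * n * v * s) = n * n * δ * v * s := by ring
  have e3 : v * s * (n * n * δ) = n * n * δ * v * s := by ring
  omega

theorem hittingTime_le {n w δ s μ : ℕ} (hn : 1 ≤ n) (hw : 1 ≤ w) (hδ : 1 ≤ δ) (hs : 1 ≤ s) :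
    hittingTime n w δ s μ ≤ gridSize n w δ s ^ (9 * numSteps n w s μ) := by
  obtain ⟨h1, h2, h3, hq, -, hv⟩ := gridSize_bounds hn hw hδ hs
  have hm : 3 ≤ numSteps n w s μ := by
    have : 1 * 1 ≤ effectiveWidth n w *
      (min (Nat.clog 2 (effectiveWidth n w * effectiveWidth n w * s)) μ + 1) :=
      Nat.mul_le_mul hv (by omega)
    unfold numSteps
    omega
  have hE := enumTime_le (m := numSteps n w s μ) h1 hq
  unfold hittingTime
  generalize numSteps n w s μ = m at *
  generalize gridSize n w δ s = q at *
  generalize effectiveWidth n w = v at *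
  have hv1 : v ≤ v * s := Nat.le_mul_of_pos_right _ hs
  have hs1 : s ≤ v * s := Nat.le_mul_of_pos_left _ hv
  have hc : Nat.clog 2 (v * v * s) ≤ q * q := by
    rw [Nat.clog_le_iff_le_pow (by norm_num)]
    refine le_trans ?_ Nat.lt_two_pow_self.le
    rw [mul_assoc]
    exact Nat.mul_le_mul (by omega) h3
  -- Uses `3 ≤ m`; the extra factor `q` covers the preparation.
  have h4 : q ^ (4 * m + 13) ≤ q ^ (9 * m) := Nat.pow_le_pow_right (by omega) (by omega)
  refine le_trans ?_ h4
  have h5 : q ^ (4 * m + 13) = q * q ^ (4 * m + 12) := by ring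
  have h6 : q ^ 6 ≤ q ^ (4 * m + 12) := Nat.pow_le_pow_right (by omega) (by omega)
  have h7 : 3 ^ 4 ≤ q ^ 4 := Nat.pow_le_pow_left hq 4
  have h8 : 3 ^ 4 * (q * q) ≤ q ^ 4 * (q * q) := Nat.mul_le_mul_right _ h7
  have h9 : q ^ 6 = q ^ 4 * (q * q) := by ring
  have h10 : 3 * q ≤ q * q := Nat.mul_le_mul_right _ hq
  have h11 : 3 * q ^ (4 * m + 12) ≤ q * q ^ (4 * m + 12) := Nat.mul_le_mul_right _ hq
  omega

/-- The time is polynomial in `(n * δ * s) ^ (ℓ * w ^ 2)`. -/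
theorem gridSize_pow_le {n w δ s μ : ℕ} (hn : 1 ≤ n) (hw : 1 ≤ w) (hδ : 1 ≤ δ) (hs : 1 ≤ s) :
    gridSize n w δ s ^ (9 * numSteps n w s μ) ≤
      3 ^ 27 * ((n * δ * s) ^ (supportBound w s μ * w ^ 2)) ^ 135 := by
  obtain ⟨-, -, -, -, hq, -⟩ := gridSize_bounds hn hw hδ hs
  have hX : 1 ≤ n * δ * s := Nat.mul_pos (Nat.mul_pos hn hδ) hs
  have hw2 : 1 ≤ w ^ 2 := Nat.one_le_pow _ _ hw
  by_cases h1 : n = 1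
  · subst h1
    have hG : min (Nat.clog 2 s) μ + 1 ≤ supportBound w s μ := by
      have : Nat.clog 2 s ≤ Nat.clog 2 (w ^ 2 * s) :=
        Nat.clog_mono_right 2 (Nat.le_mul_of_pos_left _ hw2)
      unfold supportBound
      omega
    have hm : numSteps 1 w s μ = 3 * (min (Nat.clog 2 s) μ + 1) := by
      simp [numSteps, effectiveWidth]
    have hq' : gridSize 1 w δ s ≤ 3 * (δ * s) := by
      simpa [effectiveWidth] using hq
    rw [hm]
    rw [one_mul] at hX ⊢
    -- Powers of 1 absorb nothing. Here `q ≤ 3` and there are 3 steps, whence the constant `3 ^ 27`.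
    by_cases hX1 : δ * s = 1
    · have hs1 : s = 1 := Nat.eq_one_of_mul_eq_one_left hX1
      rw [hX1] at hq' ⊢
      subst hs1
      simp only [Nat.clog_one_right, Nat.zero_min, zero_add, mul_one, one_pow]
      exact Nat.pow_le_pow_left hq' 27
    · have hX2 : 2 ≤ δ * s := by omega
      generalize δ * s = X at *
      have hqX : gridSize 1 w δ s ≤ X ^ 3 := by
        refine hq'.trans ?_
        have : 2 * 2 ≤ X * X := Nat.mul_le_mul hX2 hX2
        calc 3 * X ≤ X * X * X := Nat.mul_le_mul_right _ (by omega)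
          _ = X ^ 3 := by ring
      refine le_trans ?_ (Nat.le_mul_of_pos_left _ (by norm_num))
      calc _ ≤ (X ^ 3) ^ (9 * (3 * (min (Nat.clog 2 s) μ + 1))) := Nat.pow_le_pow_left hqX _
        _ = X ^ (81 * ((min (Nat.clog 2 s) μ + 1) * 1)) := by rw [← pow_mul]; ring_nf
        _ ≤ X ^ (135 * (supportBound w s μ * w ^ 2)) :=
          Nat.pow_le_pow_right hX (Nat.mul_le_mul (by norm_num) (Nat.mul_le_mul hG hw2))
        _ = _ := by rw [← pow_mul, mul_comm]
  · have hn2 : 2 ≤ n := by omega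
    have hev : effectiveWidth n w = w := if_neg h1
    have hX2 : 2 ≤ n * δ * s := by
      calc 2 ≤ n := hn2
        _ ≤ n * (δ * s) := Nat.le_mul_of_pos_right _ (Nat.mul_pos hδ hs)
        _ = n * δ * s := by ring
    have hG : min (Nat.clog 2 (w * w * s)) μ + 1 ≤ supportBound w s μ := by
      unfold supportBound
      rw [sq]
      omega
    rw [numSteps, hev]
    rw [hev] at hq
    have hnX : n ≤ n * δ * s := by
      rw [mul_assoc]; exact Nat.le_mul_of_pos_right _ (Nat.mul_pos hδ hs)
    -- The linear factor `w` is absorbed by `w ≤ X ^ w`, valid as `2 ≤ X`. Together with the factor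
    -- `w` in the number of steps this gives `w ^ 2`, and `135 = 5 * 27`.
    have hqX : gridSize n w δ s ≤ (n * δ * s) ^ (5 * w) := by
      generalize hXX : n * δ * s = X at *
      have h3 : 3 ≤ X ^ 2 := by nlinarith
      have hwX : w ≤ X ^ w := (Nat.lt_pow_self (by omega)).le
      calc _ ≤ 3 * (n * n * δ * w * s) := hq
        _ = 3 * (n * (X * w)) := by rw [← hXX]; ring
        _ ≤ X ^ 2 * (X * (X * X ^ w)) := by gcongr
        _ = X ^ (4 + w) := by ring
        _ ≤ X ^ (5 * w) := Nat.pow_le_pow_right hX (by omega)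
    generalize n * δ * s = X at *
    refine le_trans ?_ (Nat.le_mul_of_pos_left _ (by norm_num))
    calc _ ≤ (X ^ (5 * w)) ^ (9 * (3 * (w * (min (Nat.clog 2 (w * w * s)) μ + 1)))) :=
          Nat.pow_le_pow_left hqX _
      _ = X ^ (135 * ((min (Nat.clog 2 (w * w * s)) μ + 1) * w ^ 2)) := by
          rw [← pow_mul]; ring_nf
      _ ≤ X ^ (135 * (supportBound w s μ * w ^ 2)) :=
        Nat.pow_le_pow_right hX (Nat.mul_le_mul_left _ (Nat.mul_le_mul_right _ hG))
      _ = _ := by rw [← pow_mul, mul_comm]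

end FieldRAM

end TimeBound

/-! ### The hitting sets -/

section HittingSets

namespace FieldRAM

variable {K : Type*} [Field K]

theorem one_add_gridSize_pow_le {n w δ s μ : ℕ} (hn : 1 ≤ n) (hw : 1 ≤ w) (hδ : 1 ≤ δ)
    (hs : 1 ≤ s) : (1 + gridSize n w δ s * gridSize n w δ s) ^ numSteps n w s μ ≤
      gridSize n w δ s ^ (9 * numSteps n w s μ) ∧
      gridSize n w δ s ≤ gridSize n w δ s ^ (9 * numSteps n w s μ) := by
  obtain ⟨-, -, -, hq, -, hv⟩ := gridSize_bounds hn hw hδ hs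
  have hm : 1 ≤ numSteps n w s μ :=
    Nat.mul_pos (by norm_num) (Nat.mul_pos hv (Nat.succ_pos _))
  generalize gridSize n w δ s = q at *
  refine ⟨?_, Nat.le_self_pow (by omega) q⟩
  calc _ ≤ (q ^ 3) ^ numSteps n w s μ := Nat.pow_le_pow_left (by nlinarith) _
    _ = q ^ (3 * numSteps n w s μ) := by rw [← pow_mul]
    _ ≤ _ := Nat.pow_le_pow_right (by omega) (by omega)

/-- The program for the width, the degree and the sparsity also serves for univariate factors. -/
def univariateProg : Prog :=
  .seq (straight (.const 3 1) [.const 4 1]) hittingProg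

theorem univariateProg_spec {a : ℕ → K} {n w δ : ℕ} (hn : 1 ≤ n) :
    Triple a (fun σ => σ = start [n, w, δ]) univariateProg (2 + hittingTime n w δ 1 1)
      (fun σ => ∃ pts : List (Fin n → K), σ.out = coords pts ∧
        pts.length = (1 + gridSize n w δ 1 * gridSize n w δ 1) ^ numSteps n w 1 1 ∧
        ∀ p ∈ reachSet a n (gridSize n w δ 1) (numSteps n w 1 1), p ∈ pts) := by
  refine Triple.seq (Triple.straight ?_ (by simp)) (hittingProg_spec hn)
  rintro σ rfl
  refine ⟨?_, ?_, ?_, ?_, ?_, ?_⟩ <;> simp [Instr.step, start]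

theorem eval_C_mul_X_pow_add (c e d y : ℕ) :
    (Polynomial.C c * Polynomial.X ^ e + Polynomial.C d).eval y = c * y ^ e + d := by
  simp

theorem supportBound_one_le (w : ℕ) : supportBound w 1 1 ≤ 3 := by
  unfold supportBound
  omega

end FieldRAM

end HittingSets

theorem theorem3 :
    (∃ (A : FieldRAM.Prog) (P : Polynomial ℕ),
      ∀ (n w δ s μ : ℕ), 1 ≤ n → 1 ≤ w → 1 ≤ δ → 1 ≤ s →
      ∀ (T : ℕ), T = P.eval ((n * δ * s) ^ (supportBound w s μ * w ^ 2)) →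
      ∀ (F K : Type*) [Field F] [Field K] [Algebra F K] (a : ℕ → K),
        Set.InjOn a (Set.Iio T) →
        ∃ pts : List (Fin n → K),
          pts.length ≤ T ∧
          FieldRAM.Generates A [n, w, δ, s, μ] a T pts ∧
          ∀ B : InvROABP F n w, B.DegreeLE δ → B.SparsityLE s → B.SupportLE μ →
            B.poly ≠ 0 → ∃ p ∈ pts, MvPolynomial.aeval p B.poly ≠ 0) ∧
    (∃ (A : FieldRAM.Prog) (P : Polynomial ℕ),
      ∀ (n w δ : ℕ), 1 ≤ n → 1 ≤ w → 1 ≤ δ →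
      ∀ (T : ℕ), T = P.eval ((n * δ) ^ w ^ 2) →
      ∀ (F K : Type*) [Field F] [Field K] [Algebra F K] (a : ℕ → K),
        Set.InjOn a (Set.Iio T) →
        ∃ pts : List (Fin n → K),
          pts.length ≤ T ∧
          FieldRAM.Generates A [n, w, δ] a T pts ∧
          ∀ B : InvROABP F n w, B.DegreeLE δ → B.Univariate →
            B.poly ≠ 0 → ∃ p ∈ pts, MvPolynomial.aeval p B.poly ≠ 0) := by
  classical
  constructor
  · refine ⟨FieldRAM.hittingProg, Polynomial.C (3 ^ 27) * Polynomial.X ^ 135 + Polynomial.C 0, ?_⟩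
    intro n w δ s μ hn hw hδ hs T hT F K _ _ _ a ha
    rw [FieldRAM.eval_C_mul_X_pow_add, add_zero] at hT
    have hq := FieldRAM.gridSize_pow_le (μ := μ) hn hw hδ hs
    rw [← hT] at hq
    obtain ⟨hlen, hgrid⟩ := FieldRAM.one_add_gridSize_pow_le (μ := μ) hn hw hδ hs
    obtain ⟨σ, t, ht, he, pts, hout, hl, hpts⟩ := FieldRAM.hittingProg_spec (a := a) (w := w)
      (δ := δ) (s := s) (μ := μ) hn
      (FieldRAM.start [n, w, δ, s, μ])
      ⟨by simp [FieldRAM.start], by simp [FieldRAM.start], by simp [FieldRAM.start],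
        by simp [FieldRAM.start], by simp [FieldRAM.start], rfl⟩
    refine ⟨pts, (hl.le.trans hlen).trans hq,
      ⟨σ, t, he, (ht.trans (FieldRAM.hittingTime_le hn hw hδ hs)).trans hq, hout⟩, ?_⟩
    intro B hD hS hM hB
    obtain ⟨p, hp, hpB⟩ := InvROABP.exists_mem_reachSet_aeval_ne_zero (μ := μ) hn hw hδ hs
      (ha.mono (Set.Iio_subset_Iio (hgrid.trans hq))) hD
      (InvROABP.eachFactor_lowSupport hw hS hM) (by
        generalize min (Nat.clog 2 (w * w * s)) μ = r
        nlinarith) hB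
    exact ⟨p, hpts p hp, hpB⟩
  -- The exponent is `135 * 3` because `supportBound w 1 1 ≤ 3`; the constant 2 pays for the two
  -- instructions that set `s` and `μ` to 1.
  · refine ⟨FieldRAM.univariateProg, Polynomial.C (3 ^ 27) * Polynomial.X ^ 405 + Polynomial.C 2, ?_⟩
    intro n w δ hn hw hδ T hT F K _ _ _ a ha
    have hq := FieldRAM.gridSize_pow_le (s := 1) (μ := 1) hn hw hδ le_rfl
    have hX : 1 ≤ n * δ := Nat.mul_pos hn hδ
    have hY : (n * δ * 1) ^ (supportBound w 1 1 * w ^ 2) ≤ ((n * δ) ^ w ^ 2) ^ 3 := by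
      rw [mul_one, ← pow_mul, mul_comm (w ^ 2)]
      exact Nat.pow_le_pow_right hX
        (Nat.mul_le_mul_right _ (FieldRAM.supportBound_one_le w))
    replace hq := hq.trans (Nat.mul_le_mul_left (3 ^ 27) (Nat.pow_le_pow_left hY 135))
    rw [← pow_mul] at hq
    rw [FieldRAM.eval_C_mul_X_pow_add] at hT
    replace hq := (Nat.add_le_add_right hq 2).trans_eq hT.symm
    clear hT
    obtain ⟨hlen, hgrid⟩ := FieldRAM.one_add_gridSize_pow_le (s := 1) (μ := 1) hn hw hδ le_rfl
    obtain ⟨σ, t, ht, he, pts, hout, hl, hpts⟩ := FieldRAM.univariateProg_spec (a := a) (w := w)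
      (δ := δ) hn _ rfl
    have htime := FieldRAM.hittingTime_le (s := 1) (μ := 1) hn hw hδ le_rfl
    refine ⟨pts, by omega, ⟨σ, t, he, by omega, hout⟩, ?_⟩
    intro B hD hU hB
    obtain ⟨p, hp, hpB⟩ := InvROABP.exists_mem_reachSet_aeval_ne_zero (s := 1) (μ := 1) hn hw hδ
      le_rfl (ha.mono (Set.Iio_subset_Iio (by omega))) hD
      -- Only `r = 1` matters, not the actual sparsity. The minimum is 0 when `w = 1`, and the
      -- summand 1 in `numSteps` makes up for it.
      (InvROABP.eachFactor_lowSupport_one hU) (by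
        generalize min (Nat.clog 2 (w * w * 1)) 1 = r
        nlinarith) hB
    exact ⟨p, hpts p hp, hpB⟩
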